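/- Let $\rho^+,\rho^-,a$ be real numbers with $|\rho^\pm|<1$ and $|a|<1$, let $\gamma>0$ be the positive root of $\gamma=a^2\gamma+1-\frac{a^2\gamma^2}{1+\gamma}$, and for $\theta\in\mathbb R$ put $f(x,\theta)=(\rho^+1_{\{x\ge\theta\}}+\rho^-1_{\{x<\theta\}})x$. Consider $$X_j=f(X_{j-1},\theta)+\xi_{j-1}+\varepsilon_j,\qquad \xi_j=a\xi_{j-1}+\zeta_j,\qquad j\ge1,$$ where the pairs $(\varepsilon_j,\zeta_j)$, $j\ge 0$, are independent, $\varepsilon_j,\zeta_j$ are independent $N(0,1)$ variables for $j\ge1$, and $(X_0,\xi_0)$ is $\mathcal F_0$-measurable, with $\mathcal F_k=\sigma(\varepsilon_i,\zeta_i: i\le k)$. Write $Z_j=(X_j,\xi_j)$, let $P^{(\theta)}$ be the one-step transition kernel of $(Z_j)$, and let $\mathbb P_\theta$ be the probability under which $X_0\sim N(0,1)$ and $\xi_0\sim N(0,\gamma)$ are independent. Then there are constants $B,C>0$, $r\in(0,1)$ and $L(v)$, $v\ge 0$, depending only on $\rho^+,\rho^-,a$ (and, for $L$, on $v$), such that the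 following holds for every $\theta$. 1. $P^{(\theta)}$ has a unique invariant probability measure $\pi_\theta$. It has a continuous density $p(x,y;\theta)$ with $0\le p\le B$, the functions $y\mapsto p(x,y;\theta)$ are integrable, and for all $v\ge0$, $n\ge1$ $$\Big|\int_\theta^{\theta+v/n}\int_{\mathbb R}p(x,y;\theta)\,dy\,dx-\frac vn\int_{\mathbb R}p(\theta,y;\theta)\,dy\Big|\le\frac{L(v)}{n^{2}}.$$ 2. (Geometric ergodicity.) For all measurable $h$ with $|h|\le1$, all $n\ge0$ and $x,y\in\mathbb R$, $$\Big|\int h\,d(P^{(\theta)})^n((x,y),\cdot)-\int h\,d\pi_\theta\Big|\le C r^{n}(1+|x|+|y|).$$ 3. Under $\mathbb P_\theta$ the process $(Z_j)$ is a Markov chain with kernel $P^{(\theta)}$ relative to $(\mathcal F_j)$, and there is a probability $\widetilde{\mathbb P}_\theta$ on the same space under which the recursions and the assumptions on the noise still hold and $(X_0,\xi_0)\sim\pi_\theta$. Under every such $\widetilde{\mathbb P}_\theta$ the process $(Z_j)$ is a Markov chain with kernel $P^{(\theta)}$, $Z_j\sim\pi_\theta$ for all $j$, and $\widetilde{\mathbb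 P}_\theta(X_j\in[\theta,\theta+v/n])=\int_\theta^{\theta+v/n}\int_{\mathbb R} p(x,y;\theta)\,dy\,dx$ for $v\ge0$, $n\ge1$. 4. For all $m\ge k\ge0$ and every random variable $H$ with $|H|\le1$ that is measurable with respect to $\sigma(X_i,\xi_i,\varepsilon_i,\zeta_i:i\ge m)$, $$\mathbb E_\theta\big|\mathbb E_\theta(H|\mathcal F_k)-\widetilde{\mathbb E}_\theta H\big|\le C r^{m-k}.$$ 5. (Geometric mixing.) For all measurable $g,h$ with $|g|\le1$, $|h|\le1$ and all $k,m\ge0$, $$\big|\mathbb E_\theta\, g(Z_k)h(Z_{k+m})-\mathbb E_\theta\, g(Z_k)\,\mathbb E_\theta\, h(Z_{k+m})\big|\le C r^m(1+r^k).$$ 6. The bounds in 4 and 5 also hold with $\widetilde{\mathbb E}_\theta$ in place of $\mathbb E_\theta$. -/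

import Mathlib

open MeasureTheory ProbabilityTheory
open scoped NNReal

namespace TAR

/-- The threshold drift `f(x, θ) = (ρ⁺ 1{x ≥ θ} + ρ⁻ 1{x < θ}) x`. -/
noncomputable def drift (ρp ρm θ x : ℝ) : ℝ :=
  (if θ ≤ x then ρp else ρm) * x

/-- One step of the recursion: from the state `z = (x, y)` and the noise `w = (ε, ζ)` to
`(f(x, θ) + y + ε, a y + ζ)`. -/
noncomputable def step (ρp ρm a θ : ℝ) (z w : ℝ × ℝ) : ℝ × ℝ :=
  (drift ρp ρm θ z.1 + z.2 + w.1, a * z.2 + w.2)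

theorem measurable_drift (ρp ρm θ : ℝ) : Measurable (drift ρp ρm θ) := by
  unfold drift
  exact (Measurable.ite measurableSet_Ici measurable_const measurable_const).mul measurable_id

theorem measurable_step (ρp ρm a θ : ℝ) :
    Measurable (fun q : (ℝ × ℝ) × (ℝ × ℝ) => step ρp ρm a θ q.1 q.2) := by
  have h := measurable_drift ρp ρm θ
  unfold step
  fun_prop

/-- The law of the noise pair `(ε_j, ζ_j)`: two independent standard Gaussian variables. -/
noncomputable def noiseLaw : Measure (ℝ × ℝ) :=
  (gaussianReal 0 1).prod (gaussianReal 0 1)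

instance : IsProbabilityMeasure noiseLaw := by
  unfold noiseLaw; infer_instance

/-- The one-step transition kernel of the chain `(X_j, ξ_j)`: the law of one step of the recursion
from a given state, driven by standard Gaussian noise. -/
noncomputable def transitionKernel (ρp ρm a θ : ℝ) : Kernel (ℝ × ℝ) (ℝ × ℝ) where
  toFun z := noiseLaw.map (step ρp ρm a θ z)
  measurable' := by
    refine Measure.measurable_of_measurable_coe _ fun s hs => ?_
    have h := measurable_step ρp ρm a θ
    have e : ∀ z, noiseLaw.map (step ρp ρm a θ z) s
        = noiseLaw (Prod.mk z ⁻¹' ((fun q : (ℝ × ℝ) × (ℝ × ℝ) => step ρp ρm a θ q.1 q.2) ⁻¹' s)) := by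
      intro z
      exact Measure.map_apply (h.comp measurable_prodMk_left) hs
    simp_rw [e]
    exact measurable_measure_prodMk_left (h hs)

instance (ρp ρm a θ : ℝ) : IsMarkovKernel (transitionKernel ρp ρm a θ) :=
  ⟨fun _ => Measure.isProbabilityMeasure_map
    ((measurable_step ρp ρm a θ).comp measurable_prodMk_left).aemeasurable⟩

/-- The measure on the plane with density `p` with respect to Lebesgue measure. -/
noncomputable def densityMeasure (p : ℝ × ℝ → ℝ) : Measure (ℝ × ℝ) :=
  (volume : Measure (ℝ × ℝ)).withDensity (fun z => ENNReal.ofReal (p z))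

section Paths

variable {Ω : Type*}

/-- `𝓕_k = σ(ε_i, ζ_i : 0 ≤ i ≤ k)`. -/
@[reducible]
def past (ε ζ : ℕ → Ω → ℝ) (k : ℕ) : MeasurableSpace Ω :=
  ⨆ i : ℕ, ⨆ _ : i ≤ k,
    MeasurableSpace.comap (ε i) inferInstance ⊔ MeasurableSpace.comap (ζ i) inferInstance

/-- `σ(X_i, ξ_i, ε_i, ζ_i : i ≥ m)`, the future of the chain and of the noises from time `m`. -/
@[reducible]
def future (X ξ ε ζ : ℕ → Ω → ℝ) (m : ℕ) : MeasurableSpace Ω :=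
  ⨆ i : ℕ, ⨆ _ : m ≤ i,
    (MeasurableSpace.comap (X i) inferInstance ⊔ MeasurableSpace.comap (ξ i) inferInstance) ⊔
    (MeasurableSpace.comap (ε i) inferInstance ⊔ MeasurableSpace.comap (ζ i) inferInstance)

/-- Under the probability `P`, the processes `X, ξ` are generated by the recursions
`X_j = f(X_{j-1}, θ) + ξ_{j-1} + ε_j`, `ξ_j = a ξ_{j-1} + ζ_j`, `j ≥ 1`, where `(X_0, ξ_0)` is
`𝓕_0`-measurable with law `μ₀`, the pairs `(ε_j, ζ_j)`, `j ≥ 0`, are independent, and for `j ≥ 1`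
they consist of two independent `N(0,1)` variables. (The variables `ε_0, ζ_0` enter only through
the initial state, hence nothing is required of their law.) -/
structure IsModel [MeasurableSpace Ω] (ρp ρm a θ : ℝ) (μ₀ : Measure (ℝ × ℝ))
    (X ξ ε ζ : ℕ → Ω → ℝ) (P : Measure Ω) : Prop where
  isProb : IsProbabilityMeasure P
  meas_ε : ∀ j, Measurable (ε j)
  meas_ζ : ∀ j, Measurable (ζ j)
  indep : iIndepFun (fun (j : ℕ) (ω : Ω) => (ε j ω, ζ j ω)) P
  noise_law : ∀ j, 1 ≤ j → P.map (fun ω => (ε j ω, ζ j ω)) = noiseLaw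
  init_X : Measurable[past ε ζ 0] (X 0)
  init_ξ : Measurable[past ε ζ 0] (ξ 0)
  init_law : P.map (fun ω => (X 0 ω, ξ 0 ω)) = μ₀
  rec_X : ∀ j ω, X (j + 1) ω = drift ρp ρm θ (X j ω) + ξ j ω + ε (j + 1) ω
  rec_ξ : ∀ j ω, ξ (j + 1) ω = a * ξ j ω + ζ (j + 1) ω

/-- The Markov property of `(X_j, ξ_j)` under `P`, relative to `(𝓕_k)`, with transition
kernel `κ`. -/
def IsMarkovChain [MeasurableSpace Ω] (κ : Kernel (ℝ × ℝ) (ℝ × ℝ))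
    (X ξ ε ζ : ℕ → Ω → ℝ) (P : Measure Ω) : Prop :=
  ∀ (k n : ℕ) (h : ℝ × ℝ → ℝ), Measurable h → (∀ z, |h z| ≤ 1) →
    P[fun ω => h (X (k + n) ω, ξ (k + n) ω) | past ε ζ k]
      =ᵐ[P] fun ω => ∫ z, h z ∂((κ ^ n) (X k ω, ξ k ω))

/-- For every `H` with `|H| ≤ 1` that depends only on the future from time `m = k + n`:
`E |E(H | 𝓕_k) - Ẽ H| ≤ C r^(m-k)`, where `E` is the expectation under `P` and `Ẽ` the one
under `Pst`. -/
def FutureForgetsPast [MeasurableSpace Ω] (C r : ℝ)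
    (X ξ ε ζ : ℕ → Ω → ℝ) (P Pst : Measure Ω) : Prop :=
  ∀ (k n : ℕ) (H : Ω → ℝ), Measurable[future X ξ ε ζ (k + n)] H → (∀ ω, |H ω| ≤ 1) →
    ∫ ω, |(P[H | past ε ζ k]) ω - ∫ ω', H ω' ∂Pst| ∂P ≤ C * r ^ n

/-- Geometric mixing under `P`:
`|E g(Z_k) h(Z_{k+m}) - E g(Z_k) E h(Z_{k+m})| ≤ C r^m (1 + r^k)`, `Z_j = (X_j, ξ_j)`. -/
def IsGeomMixing [MeasurableSpace Ω] (C r : ℝ)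
    (X ξ : ℕ → Ω → ℝ) (P : Measure Ω) : Prop :=
  ∀ (k m : ℕ) (g h : ℝ × ℝ → ℝ), Measurable g → Measurable h →
    (∀ z, |g z| ≤ 1) → (∀ z, |h z| ≤ 1) →
    |(∫ ω, g (X k ω, ξ k ω) * h (X (k + m) ω, ξ (k + m) ω) ∂P)
        - (∫ ω, g (X k ω, ξ k ω) ∂P) * ∫ ω, h (X (k + m) ω, ξ (k + m) ω) ∂P|
      ≤ C * r ^ m * (1 + r ^ k)

end Paths

end TAR

namespace TAR

section Harris

open Filter Topology ENNReal

variable {α : Type*} [MeasurableSpace α]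

theorem integrable_of_abs_le {μ : Measure α} [IsFiniteMeasure μ] {h : α → ℝ} (hm : Measurable h)
    {M : ℝ} (hM : ∀ z, |h z| ≤ M) : Integrable h μ :=
  Integrable.of_bound hm.aestronglyMeasurable M (.of_forall fun z => by simpa using hM z)

theorem abs_integral_le_of_abs_le {μ : Measure α} [IsProbabilityMeasure μ] {h : α → ℝ}
    {M : ℝ} (hM : ∀ z, |h z| ≤ M) : |∫ z, h z ∂μ| ≤ M := by
  simpa using norm_integral_le_of_norm_le_const (μ := μ) (f := h) (C := M) (.of_forall hM)

theorem integral_sub_integral_le {μ₁ μ₂ : Measure α} [IsFiniteMeasure μ₁] [IsFiniteMeasure μ₂]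
    {c β D : ℝ} (h₁ : μ₁.real Set.univ = c) (h₂ : μ₂.real Set.univ = c)
    {V h : α → ℝ} (hV₁ : Integrable V μ₁) (hV₂ : Integrable V μ₂)
    (hh₁ : Integrable h μ₁) (hh₂ : Integrable h μ₂)
    (hD : ∀ u w, |h u - h w| ≤ D * (2 + β * V u + β * V w)) :
    |∫ z, h z ∂μ₁ - ∫ z, h z ∂μ₂|
      ≤ D * (2 * c + β * ∫ z, V z ∂μ₁ + β * ∫ z, V z ∂μ₂) := by
  rcases eq_or_ne c 0 with rfl | hc
  · have e₁ : μ₁ = 0 := by simpa [measureReal_eq_zero_iff] using h₁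
    have e₂ : μ₂ = 0 := by simpa [measureReal_eq_zero_iff] using h₂
    simp [e₁, e₂]
  have hc0 : 0 < c := lt_of_le_of_ne (h₁ ▸ measureReal_nonneg) hc.symm
  have inner : ∀ u, |c * h u - ∫ w, h w ∂μ₂| ≤ D * ((2 * c + β * ∫ w, V w ∂μ₂) + c * β * V u) := by
    intro u
    have e : c * h u - ∫ w, h w ∂μ₂ = ∫ w, (h u - h w) ∂μ₂ := by
      rw [integral_sub (integrable_const _) hh₂]; simp [h₂]
    have e' : ∫ w, D * (2 + β * V u + β * V w) ∂μ₂
        = D * ((2 * c + β * ∫ w, V w ∂μ₂) + c * β * V u) := by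
      rw [integral_const_mul, integral_add (integrable_const _) (hV₂.const_mul _),
        integral_const_mul]
      simp only [integral_const, h₂, smul_eq_mul]; ring
    rw [e, ← e', ← Real.norm_eq_abs]
    refine norm_integral_le_of_norm_le ?_ (.of_forall fun w => hD u w)
    exact ((integrable_const _).add (hV₂.const_mul _)).const_mul _
  have e : c * (∫ z, h z ∂μ₁ - ∫ z, h z ∂μ₂) = ∫ u, (c * h u - ∫ w, h w ∂μ₂) ∂μ₁ := by
    rw [integral_sub (hh₁.const_mul _) (integrable_const _), integral_const_mul]
    simp [h₁]; ring
  have e' : ∫ u, D * ((2 * c + β * ∫ w, V w ∂μ₂) + c * β * V u) ∂μ₁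
      = c * (D * (2 * c + β * ∫ z, V z ∂μ₁ + β * ∫ z, V z ∂μ₂)) := by
    rw [integral_const_mul, integral_add (integrable_const _) (hV₁.const_mul _),
      integral_const_mul]
    simp only [integral_const, h₁, smul_eq_mul]; ring
  have key : |c * (∫ z, h z ∂μ₁ - ∫ z, h z ∂μ₂)|
      ≤ c * (D * (2 * c + β * ∫ z, V z ∂μ₁ + β * ∫ z, V z ∂μ₂)) := by
    rw [e, ← e', ← Real.norm_eq_abs]
    refine norm_integral_le_of_norm_le ?_ (.of_forall inner)
    exact ((integrable_const _).add (hV₁.const_mul _)).const_mul _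
  rw [abs_mul, abs_of_pos hc0] at key
  exact le_of_mul_le_mul_left key hc0

/-- A drift condition for `V` together with a minorization on the sublevel set `{V ≤ R}`. -/
structure DriftMinorization (κ : Kernel α α) (V : α → ℝ) (lam K R : ℝ) (ν : Measure α) :
    Prop where
  meas : Measurable V
  nonneg : ∀ z, 0 ≤ V z
  integrable : ∀ z, Integrable V (κ z)
  drift : ∀ z, ∫ w, V w ∂(κ z) ≤ lam * V z + K
  minor : ∀ z, V z ≤ R → ν ≤ κ z

/-- One step of the kernel contracts the weighted oscillation. -/
theorem DriftMinorization.contraction {κ : Kernel α α} [IsMarkovKernel κ] {V : α → ℝ}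
    {lam K R : ℝ} {ν : Measure α} [IsFiniteMeasure ν] (H : DriftMinorization κ V lam K R ν)
    {β ρ : ℝ} (hβ : 0 ≤ β)
    (hfar : ∀ S, R ≤ S → 2 + β * (lam * S + 2 * K) ≤ ρ * (2 + β * S))
    (hnear : ∀ S, 0 ≤ S →
      2 * (1 - ν.real Set.univ) + β * (lam * S + 2 * K) ≤ ρ * (2 + β * S))
    {h : α → ℝ} (hm : Measurable h) {M : ℝ} (hM : ∀ z, |h z| ≤ M) {D : ℝ} (hD0 : 0 ≤ D)
    (hD : ∀ u w, |h u - h w| ≤ D * (2 + β * V u + β * V w)) (x y : α) :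
    |∫ z, h z ∂(κ x) - ∫ z, h z ∂(κ y)| ≤ ρ * D * (2 + β * V x + β * V y) := by
  have hd := mul_le_mul_of_nonneg_left (add_le_add (H.drift x) (H.drift y)) hβ
  by_cases hS : V x + V y ≤ R
  · have hx : V x ≤ R := by linarith [H.nonneg y]
    have hy : V y ≤ R := by linarith [H.nonneg x]
    have ex := Measure.sub_add_cancel_of_le (H.minor x hx)
    have ey := Measure.sub_add_cancel_of_le (H.minor y hy)
    have fx : κ x - ν ≤ κ x := Measure.sub_le
    have fy : κ y - ν ≤ κ y := Measure.sub_le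
    have hmass : ∀ z, V z ≤ R → (κ z - ν).real Set.univ = 1 - ν.real Set.univ := by
      intro z hz
      have e := congrArg (fun m : Measure α => m.real Set.univ)
        (Measure.sub_add_cancel_of_le (H.minor z hz))
      rw [measureReal_add_apply (measure_ne_top _ _) (measure_ne_top _ _),
        probReal_univ (μ := κ z)] at e
      linarith
    have ib : ∀ (m : Measure α) [IsFiniteMeasure m], Integrable h m := fun m _ =>
      integrable_of_abs_le hm hM
    have key := integral_sub_integral_le (β := β) (D := D) (hmass x hx) (hmass y hy)
      ((H.integrable x).mono_measure fx) ((H.integrable y).mono_measure fy) (ib _) (ib _) hD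
    have e : ∫ z, h z ∂(κ x) - ∫ z, h z ∂(κ y)
        = ∫ z, h z ∂(κ x - ν) - ∫ z, h z ∂(κ y - ν) := by
      conv_lhs => rw [← ex, ← ey]
      rw [integral_add_measure (ib _) (ib _), integral_add_measure (ib _) (ib _)]
      ring
    have vx := integral_mono_measure fx (.of_forall H.nonneg) (H.integrable x)
    have vy := integral_mono_measure fy (.of_forall H.nonneg) (H.integrable y)
    have vd := mul_le_mul_of_nonneg_left (add_le_add vx vy) hβ
    rw [e]
    refine key.trans ?_
    have := hnear (V x + V y) (add_nonneg (H.nonneg x) (H.nonneg y))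
    rw [mul_comm ρ D, mul_assoc]
    refine mul_le_mul_of_nonneg_left ?_ hD0
    linarith
  · have key := integral_sub_integral_le (β := β) (D := D) (c := 1) (by simp) (by simp)
      (H.integrable x) (H.integrable y) (integrable_of_abs_le hm hM)
      (integrable_of_abs_le hm hM) hD
    refine key.trans ?_
    have := hfar (V x + V y) (not_le.1 hS).le
    rw [mul_comm ρ D, mul_assoc]
    refine mul_le_mul_of_nonneg_left ?_ hD0
    linarith

instance isMarkovKernel_pow (κ : Kernel α α) [IsMarkovKernel κ] (n : ℕ) :
    IsMarkovKernel (κ ^ n) := by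
  induction n with
  | zero => rw [pow_zero]; exact inferInstanceAs (IsMarkovKernel Kernel.id)
  | succ n ih => rw [pow_succ]; exact inferInstanceAs (IsMarkovKernel ((κ ^ n) ∘ₖ κ))

theorem integral_pow_zero (κ : Kernel α α) {h : α → ℝ} (hm : Measurable h) (x : α) :
    ∫ z, h z ∂((κ ^ 0) x) = h x := by
  rw [pow_zero]
  change ∫ z, h z ∂(Kernel.id x) = h x
  rw [Kernel.id_apply, integral_dirac' _ _ hm.stronglyMeasurable]

theorem integral_pow_add (κ : Kernel α α) [IsMarkovKernel κ] {h : α → ℝ} (hm : Measurable h)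
    {M : ℝ} (hM : ∀ z, |h z| ≤ M) (m n : ℕ) (x : α) :
    ∫ z, h z ∂((κ ^ (m + n)) x) = ∫ y, ∫ z, h z ∂((κ ^ m) y) ∂((κ ^ n) x) := by
  rw [Kernel.pow_add, Kernel.integral_comp (integrable_of_abs_le hm hM)]

theorem integral_pow_succ (κ : Kernel α α) [IsMarkovKernel κ] {h : α → ℝ} (hm : Measurable h)
    {M : ℝ} (hM : ∀ z, |h z| ≤ M) (n : ℕ) (x : α) :
    ∫ z, h z ∂((κ ^ (n + 1)) x) = ∫ y, ∫ z, h z ∂((κ ^ n) y) ∂(κ x) := by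
  simpa using integral_pow_add κ hm hM n 1 x

theorem measurable_integral_kernel {γ : Type*} [MeasurableSpace γ] (κ : Kernel γ α)
    [IsMarkovKernel κ] {h : α → ℝ}
    (hm : Measurable h) : Measurable fun x => ∫ z, h z ∂(κ x) :=
  (hm.stronglyMeasurable.comp_measurable measurable_snd).integral_kernel_prod_right'.measurable

theorem DriftMinorization.pow_contraction {κ : Kernel α α} [IsMarkovKernel κ] {V : α → ℝ}
    {lam K R : ℝ} {ν : Measure α} [IsFiniteMeasure ν] (H : DriftMinorization κ V lam K R ν)
    {β ρ : ℝ} (hβ : 0 ≤ β) (hρ : 0 ≤ ρ)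
    (hfar : ∀ S, R ≤ S → 2 + β * (lam * S + 2 * K) ≤ ρ * (2 + β * S))
    (hnear : ∀ S, 0 ≤ S →
      2 * (1 - ν.real Set.univ) + β * (lam * S + 2 * K) ≤ ρ * (2 + β * S))
    {h : α → ℝ} (hm : Measurable h) (hM : ∀ z, |h z| ≤ 1) (n : ℕ) (x y : α) :
    |∫ z, h z ∂((κ ^ n) x) - ∫ z, h z ∂((κ ^ n) y)| ≤ ρ ^ n * (2 + β * V x + β * V y) := by
  induction n generalizing x y with
  | zero =>
    rw [integral_pow_zero κ hm, integral_pow_zero κ hm]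
    have h1 := mul_nonneg hβ (H.nonneg x)
    have h2 := mul_nonneg hβ (H.nonneg y)
    have := abs_sub (h x) (h y)
    have := hM x
    have := hM y
    simp only [pow_zero, one_mul]
    linarith
  | succ n ih =>
    rw [integral_pow_succ κ hm hM, integral_pow_succ κ hm hM, pow_succ' ρ]
    exact H.contraction hβ hfar hnear (measurable_integral_kernel _ hm)
      (fun z => abs_integral_le_of_abs_le hM) (pow_nonneg hρ n) ih x y

/-- A choice of the weight `β` and of the rate `ρ` for the contraction. -/
theorem exists_contraction_constants {lam K R c : ℝ} (hl0 : 0 < lam) (hl : lam < 1) (hK : 0 < K)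
    (hR : 4 * K ≤ (1 - lam) * R) (hc : 0 < c) :
    ∃ β ρ : ℝ, 0 < β ∧ 0 < ρ ∧ ρ < 1 ∧
      (∀ S, R ≤ S → 2 + β * (lam * S + 2 * K) ≤ ρ * (2 + β * S)) ∧
      (∀ S, 0 ≤ S → 2 * (1 - c) + β * (lam * S + 2 * K) ≤ ρ * (2 + β * S)) := by
  have hR0 : 0 < R := by
    by_contra hcon
    nlinarith [mul_nonneg (sub_nonneg.2 hl.le) (neg_nonneg.2 (not_lt.1 hcon))]
  set β := c / (2 * K) with hβd
  have hβ : 0 < β := by positivity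
  have hβK : β * (2 * K) = c := by rw [hβd]; field_simp
  set σ := (2 + β * R * ((1 + lam) / 2)) / (2 + β * R) with hσd
  have hden : 0 < 2 + β * R := by positivity
  have hσ : σ * (2 + β * R) = 2 + β * R * ((1 + lam) / 2) := by rw [hσd]; field_simp
  have hσ1 : σ < 1 := by
    rw [hσd, div_lt_one hden]
    nlinarith [mul_pos hβ hR0]
  have hσl : (1 + lam) / 2 ≤ σ := by
    rw [hσd, le_div_iff₀ hden]
    nlinarith
  refine ⟨β, max (max (1 - c / 2) lam) σ, hβ, lt_max_of_lt_left (lt_max_of_lt_right hl0),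
    max_lt (max_lt (by linarith) hl) hσ1, fun S hS => ?_, fun S hS => ?_⟩
  · have hS0 : 0 < S := hR0.trans_le hS
    have h1 : σ * (2 + β * S) ≤ max (max (1 - c / 2) lam) σ * (2 + β * S) :=
      mul_le_mul_of_nonneg_right (le_max_right _ _) (by positivity)
    refine le_trans ?_ h1
    have h2 : 2 * K ≤ (1 - lam) / 2 * S := by nlinarith
    have h3 := mul_le_mul_of_nonneg_left h2 hβ.le
    have h4 : 0 ≤ β * (S - R) * (σ - (1 + lam) / 2) :=
      mul_nonneg (mul_nonneg hβ.le (sub_nonneg.2 hS)) (sub_nonneg.2 hσl)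
    nlinarith
  · have h1 : 1 - c / 2 ≤ max (max (1 - c / 2) lam) σ :=
      (le_max_left _ _).trans (le_max_left _ _)
    have h2 : lam ≤ max (max (1 - c / 2) lam) σ := (le_max_right _ _).trans (le_max_left _ _)
    have h3 := mul_le_mul_of_nonneg_right h2 (mul_nonneg hβ.le hS)
    nlinarith

end Harris

section Harris

open Filter Topology ENNReal

variable {α : Type*} [MeasurableSpace α]

/-- A sequence of dominated probability measures that is geometrically Cauchy in total variation
converges, in total variation hence on bounded measurable functions. -/
theorem exists_tendsto_of_geometric {μ : ℕ → Measure α} [∀ n, IsProbabilityMeasure (μ n)]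
    {ν : Measure α} [SigmaFinite ν] (hac : ∀ n, μ n ≪ ν) {C r : ℝ} (hr : r < 1)
    (hC : ∀ h : α → ℝ, Measurable h → (∀ z, |h z| ≤ 1) → ∀ n,
      |∫ z, h z ∂(μ n) - ∫ z, h z ∂(μ (n + 1))| ≤ C * r ^ n) :
    ∃ π : Measure α, IsProbabilityMeasure π ∧ ∀ h : α → ℝ, Measurable h → (∀ z, |h z| ≤ 1) →
      Tendsto (fun n => ∫ z, h z ∂(μ n)) atTop (𝓝 (∫ z, h z ∂π)) := by
  set f : ℕ → α → ℝ := fun n z => ((μ n).rnDeriv ν z).toReal with hf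
  have fmeas : ∀ n, Measurable (f n) := fun n => (Measure.measurable_rnDeriv _ _).ennreal_toReal
  have fnn : ∀ n z, 0 ≤ f n z := fun n z => ENNReal.toReal_nonneg
  have fint : ∀ n, Integrable (f n) ν := fun n => Measure.integrable_toReal_rnDeriv
  have fh : ∀ n (h : α → ℝ), ∫ z, f n z * h z ∂ν = ∫ z, h z ∂(μ n) := fun n h =>
    integral_rnDeriv_smul (hac n)
  have hbd : ∀ (g h : α → ℝ), Integrable g ν → Measurable h → (∀ z, |h z| ≤ 1) →
      Integrable (fun z => g z * h z) ν := fun g h hg hm h1 =>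
    hg.mul_bdd (c := 1) hm.aestronglyMeasurable (.of_forall fun z => by simpa using h1 z)
  have hdist : ∀ n, dist ((fint n).toL1 (f n)) ((fint (n + 1)).toL1 (f (n + 1))) ≤ C * r ^ n := by
    intro n
    rw [L1.dist_eq_integral_dist]
    classical
    set s : α → ℝ := fun z => if f (n + 1) z ≤ f n z then 1 else -1 with hs
    have sm : Measurable s :=
      Measurable.ite (measurableSet_le (fmeas _) (fmeas _)) measurable_const measurable_const
    have s1 : ∀ z, |s z| ≤ 1 := fun z => by
      simp only [hs]; split_ifs <;> simp
    have e : ∫ z, dist ((fint n).toL1 (f n) z) ((fint (n + 1)).toL1 (f (n + 1)) z) ∂ν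
        = ∫ z, (f n z * s z - f (n + 1) z * s z) ∂ν := by
      refine integral_congr_ae ?_
      filter_upwards [(fint n).coeFn_toL1, (fint (n + 1)).coeFn_toL1] with z h1 h2
      rw [h1, h2, Real.dist_eq]
      simp only [hs]
      split_ifs with h
      · rw [abs_of_nonneg (by linarith)]; ring
      · rw [abs_of_neg (by linarith [not_le.1 h])]; ring
    rw [e, integral_sub (hbd _ _ (fint _) sm s1) (hbd _ _ (fint _) sm s1), fh, fh]
    exact (le_abs_self _).trans (hC s sm s1 n)
  obtain ⟨F, hF⟩ := cauchySeq_tendsto_of_complete (cauchySeq_of_le_geometric r C hr hdist)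
  have Fint : Integrable F ν := L1.integrable_coeFn F
  have Fm : Measurable F := L1.measurable_coeFn F
  have Pint : Integrable (fun z => max (F z) 0) ν := Fint.pos_part
  have hlim : ∀ h : α → ℝ, Measurable h → (∀ z, |h z| ≤ 1) →
      Tendsto (fun n => ∫ z, h z ∂(μ n)) atTop (𝓝 (∫ z, max (F z) 0 * h z ∂ν)) := by
    intro h hm h1
    rw [tendsto_iff_dist_tendsto_zero]
    refine squeeze_zero (fun _ => dist_nonneg) (fun n => ?_) (tendsto_iff_dist_tendsto_zero.1 hF)
    rw [Real.dist_eq, ← fh n h, ← integral_sub (hbd _ _ (fint _) hm h1) (hbd _ _ Pint hm h1),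
      L1.dist_eq_integral_dist]
    have e : ∫ z, dist ((fint n).toL1 (f n) z) (F z) ∂ν = ∫ z, |f n z - F z| ∂ν := by
      refine integral_congr_ae ?_
      filter_upwards [(fint n).coeFn_toL1] with z h1
      rw [h1, Real.dist_eq]
    rw [e, ← Real.norm_eq_abs]
    refine norm_integral_le_of_norm_le ((fint n).sub Fint).abs (.of_forall fun z => ?_)
    rw [← sub_mul, norm_mul, Real.norm_eq_abs, Real.norm_eq_abs]
    have h2 : |f n z - max (F z) 0| ≤ |f n z - F z| := by
      have := abs_max_sub_max_le_abs (f n z) (F z) 0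
      rwa [max_eq_left (fnn n z)] at this
    exact (mul_le_of_le_one_right (abs_nonneg _) (h1 z)).trans h2
  have hone : ∫ z, max (F z) 0 ∂ν = 1 := by
    have := hlim (fun _ => 1) measurable_const (by simp)
    simp only [integral_const, probReal_univ, smul_eq_mul, mul_one] at this
    exact tendsto_nhds_unique this tendsto_const_nhds
  refine ⟨ν.withDensity fun z => ENNReal.ofReal (max (F z) 0), ⟨?_⟩, fun h hm h1 => ?_⟩
  · rw [withDensity_apply _ .univ, Measure.restrict_univ,
      ← ofReal_integral_eq_lintegral_ofReal Pint (.of_forall fun z => le_max_right _ _), hone,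
      ENNReal.ofReal_one]
  · rw [integral_withDensity_eq_integral_toReal_smul
      (Fm.max measurable_const).ennreal_ofReal (.of_forall fun _ => ENNReal.ofReal_lt_top)]
    simp only [ENNReal.toReal_ofReal (le_max_right _ _), smul_eq_mul]
    exact hlim h hm h1

theorem integrable_of_lintegral_ofReal_le {μ : Measure α} {V : α → ℝ} (hm : Measurable V)
    (h0 : ∀ z, 0 ≤ V z) {M : ℝ} (hM0 : 0 ≤ M)
    (hM : ∫⁻ z, ENNReal.ofReal (V z) ∂μ ≤ ENNReal.ofReal M) :
    Integrable V μ ∧ ∫ z, V z ∂μ ≤ M := by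
  refine ⟨⟨hm.aestronglyMeasurable, ?_⟩, ?_⟩
  · rw [hasFiniteIntegral_iff_ofReal (.of_forall h0)]
    exact hM.trans_lt ENNReal.ofReal_lt_top
  · rw [integral_eq_lintegral_of_nonneg_ae (.of_forall h0) hm.aestronglyMeasurable]
    exact ENNReal.toReal_le_of_le_ofReal hM0 hM

theorem DriftMinorization.lintegral_bind_le {κ : Kernel α α} {V : α → ℝ}
    {lam K R : ℝ} {ν : Measure α} (H : DriftMinorization κ V lam K R ν)
    (hl : 0 ≤ lam) (hK : 0 ≤ K) {M : ℝ} (hM0 : 0 ≤ M) (hM : lam * M + K ≤ M)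
    {μ : Measure α} [IsProbabilityMeasure μ]
    (hμ : ∫⁻ z, ENNReal.ofReal (V z) ∂μ ≤ ENNReal.ofReal M) :
    ∫⁻ z, ENNReal.ofReal (V z) ∂(μ.bind κ) ≤ ENNReal.ofReal M := by
  rw [Measure.lintegral_bind κ.aemeasurable H.meas.ennreal_ofReal.aemeasurable]
  calc ∫⁻ z, ∫⁻ w, ENNReal.ofReal (V w) ∂(κ z) ∂μ
      ≤ ∫⁻ z, (ENNReal.ofReal lam * ENNReal.ofReal (V z) + ENNReal.ofReal K) ∂μ := by
        refine lintegral_mono fun z => ?_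
        rw [← ofReal_integral_eq_lintegral_ofReal (H.integrable z) (.of_forall H.nonneg),
          ← ENNReal.ofReal_mul hl, ← ENNReal.ofReal_add (mul_nonneg hl (H.nonneg z)) hK]
        exact ENNReal.ofReal_le_ofReal (H.drift z)
    _ = ENNReal.ofReal lam * ∫⁻ z, ENNReal.ofReal (V z) ∂μ + ENNReal.ofReal K := by
        rw [lintegral_add_right _ measurable_const,
          lintegral_const_mul _ H.meas.ennreal_ofReal]
        simp
    _ ≤ ENNReal.ofReal lam * ENNReal.ofReal M + ENNReal.ofReal K := by gcongr
    _ = ENNReal.ofReal (lam * M + K) := by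
        rw [← ENNReal.ofReal_mul hl, ENNReal.ofReal_add (mul_nonneg hl hM0) hK]
    _ ≤ ENNReal.ofReal M := ENNReal.ofReal_le_ofReal hM

theorem pow_succ_apply_eq_bind (κ : Kernel α α) (n : ℕ) (x : α) :
    (κ ^ (n + 1)) x = ((κ ^ n) x).bind κ := by
  rw [pow_succ']
  exact Kernel.comp_apply κ (κ ^ n) x

theorem invariant_pow {κ : Kernel α α} {μ : Measure α} (h : κ.Invariant μ) (n : ℕ) :
    (κ ^ n).Invariant μ := by
  induction n with
  | zero =>
    rw [pow_zero]
    exact Measure.bind_dirac (m := μ)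
  | succ n ih => rw [pow_succ']; exact h.comp ih

theorem integral_bind_kernel {γ : Type*} [MeasurableSpace γ] (μ : Measure γ)
    [IsProbabilityMeasure μ] (κ : Kernel γ α)
    [IsMarkovKernel κ] {h : α → ℝ} (hm : Measurable h) {M : ℝ} (hM : ∀ z, |h z| ≤ M) :
    ∫ z, h z ∂(μ.bind κ) = ∫ x, ∫ z, h z ∂(κ x) ∂μ := by
  have e : μ.bind κ = (κ ∘ₖ Kernel.const Unit μ) () := by
    rw [Kernel.comp_apply, Kernel.const_apply]
  rw [e, Kernel.integral_comp (integrable_of_abs_le hm hM), Kernel.const_apply]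

theorem ext_of_integral_eq {μ₁ μ₂ : Measure α} [IsProbabilityMeasure μ₁]
    [IsProbabilityMeasure μ₂] (h : ∀ h : α → ℝ, Measurable h → (∀ z, |h z| ≤ 1) →
      ∫ z, h z ∂μ₁ = ∫ z, h z ∂μ₂) : μ₁ = μ₂ := by
  ext s hs
  have := h (s.indicator 1) (measurable_one.indicator hs) fun z => by
    by_cases hz : z ∈ s <;> simp [hz]
  rw [integral_indicator_one hs, integral_indicator_one hs] at this
  exact (measureReal_eq_measureReal_iff (measure_ne_top _ _) (measure_ne_top _ _)).1 this

/-- **Harris' theorem** with explicit constants. -/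
theorem DriftMinorization.exists_invariant {κ : Kernel α α} [IsMarkovKernel κ] {V : α → ℝ}
    {lam K R : ℝ} {ν : Measure α} [IsFiniteMeasure ν] (H : DriftMinorization κ V lam K R ν)
    (hl : 0 ≤ lam) (hK : 0 ≤ K) {β ρ : ℝ} (hβ : 0 ≤ β) (hρ : 0 ≤ ρ) (hρ1 : ρ < 1)
    (hfar : ∀ S, R ≤ S → 2 + β * (lam * S + 2 * K) ≤ ρ * (2 + β * S))
    (hnear : ∀ S, 0 ≤ S →
      2 * (1 - ν.real Set.univ) + β * (lam * S + 2 * K) ≤ ρ * (2 + β * S))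
    {vol : Measure α} [SigmaFinite vol] (hac : ∀ z, κ z ≪ vol)
    {x₀ : α} {M : ℝ} (hM0 : V x₀ ≤ M) (hM : lam * M + K ≤ M) :
    ∃ π : Measure α, IsProbabilityMeasure π ∧ κ.Invariant π ∧
      ∫⁻ z, ENNReal.ofReal (V z) ∂π ≤ ENNReal.ofReal M ∧
      (∀ h : α → ℝ, Measurable h → (∀ z, |h z| ≤ 1) → ∀ n x,
        |∫ z, h z ∂((κ ^ n) x) - ∫ z, h z ∂π| ≤ ρ ^ n * (2 + β * V x + β * M)) ∧
      ∀ μ : Measure α, IsProbabilityMeasure μ → κ.Invariant μ → μ = π := by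
  have M0 : 0 ≤ M := (H.nonneg x₀).trans hM0
  have hmom : ∀ n, ∫⁻ z, ENNReal.ofReal (V z) ∂((κ ^ n) x₀) ≤ ENNReal.ofReal M := by
    intro n
    induction n with
    | zero =>
      rw [pow_zero]
      change ∫⁻ z, ENNReal.ofReal (V z) ∂(Kernel.id x₀) ≤ _
      rw [Kernel.id_apply, lintegral_dirac' _ H.meas.ennreal_ofReal]
      exact ENNReal.ofReal_le_ofReal hM0
    | succ n ih =>
      rw [pow_succ_apply_eq_bind]
      exact H.lintegral_bind_le hl hK M0 hM ih
  have hmix : ∀ (μ : Measure α) [IsProbabilityMeasure μ],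
      ∫⁻ z, ENNReal.ofReal (V z) ∂μ ≤ ENNReal.ofReal M → ∀ h : α → ℝ, Measurable h →
      (∀ z, |h z| ≤ 1) → ∀ n x,
      |∫ z, h z ∂((κ ^ n) x) - ∫ y, ∫ z, h z ∂((κ ^ n) y) ∂μ| ≤ ρ ^ n * (2 + β * V x + β * M) := by
    intro μ _ hμ h hm h1 n x
    obtain ⟨Vi, Vle⟩ := integrable_of_lintegral_ofReal_le H.meas H.nonneg M0 hμ
    have i1 : Integrable (fun y => ∫ z, h z ∂((κ ^ n) y)) μ :=
      integrable_of_abs_le (measurable_integral_kernel _ hm) fun y => abs_integral_le_of_abs_le h1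
    have e : ∫ z, h z ∂((κ ^ n) x) - ∫ y, ∫ z, h z ∂((κ ^ n) y) ∂μ
        = ∫ y, (∫ z, h z ∂((κ ^ n) x) - ∫ z, h z ∂((κ ^ n) y)) ∂μ := by
      rw [integral_sub (integrable_const _) i1]; simp
    have i2 : Integrable (fun y => ρ ^ n * (2 + β * V x + β * V y)) μ :=
      ((integrable_const _).add (Vi.const_mul _)).const_mul _
    have e2 : ∫ y, ρ ^ n * (2 + β * V x + β * V y) ∂μ
        = ρ ^ n * (2 + β * V x + β * ∫ y, V y ∂μ) := by
      rw [integral_const_mul, integral_add (integrable_const _) (Vi.const_mul _),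
        integral_const_mul]
      simp
    rw [e, ← Real.norm_eq_abs]
    refine (norm_integral_le_of_norm_le i2 (.of_forall fun y =>
      H.pow_contraction hβ hρ hfar hnear hm h1 n x y)).trans ?_
    rw [e2]
    gcongr
  obtain ⟨π, hπ, hlim⟩ := exists_tendsto_of_geometric (μ := fun n => (κ ^ (n + 1)) x₀)
    (ν := vol) (C := ρ * (2 + β * V x₀ + β * M)) (r := ρ) (fun n => by
      rw [pow_succ_apply_eq_bind]
      refine Measure.AbsolutelyContinuous.mk fun s hs h0 => ?_
      rw [Measure.bind_apply hs κ.aemeasurable]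
      simp [hac _ h0]) hρ1 (fun h hm h1 n => by
      have := hmix ((κ ^ 1) x₀) (hmom 1) h hm h1 (n + 1) x₀
      rw [← integral_pow_add κ hm h1 (n + 1) 1 x₀, pow_succ' ρ, mul_right_comm] at this
      exact this)
  have hinv : κ.Invariant π := by
    have : IsProbabilityMeasure (π.bind κ) :=
      isProbabilityMeasure_bind κ.aemeasurable (.of_forall fun _ => inferInstance)
    refine ext_of_integral_eq fun h hm h1 => ?_
    rw [integral_bind_kernel π κ hm h1]
    refine tendsto_nhds_unique (hlim _ (measurable_integral_kernel κ hm)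
      fun z => abs_integral_le_of_abs_le h1) ?_
    refine ((tendsto_add_atTop_iff_nat 1).2 (hlim h hm h1)).congr fun n => ?_
    rw [add_comm (n + 1) 1, integral_pow_add κ hm h1 1 (n + 1) x₀, pow_one]
  have hπV : ∫⁻ z, ENNReal.ofReal (V z) ∂π ≤ ENNReal.ofReal M := by
    have hN : ∀ N : ℕ, ∫⁻ z, ENNReal.ofReal (min (V z) (N + 1)) ∂π ≤ ENNReal.ofReal M := by
      intro N
      have N0 : (0 : ℝ) < N + 1 := by positivity
      have gm : Measurable fun z => min (V z) (N + 1) := H.meas.min measurable_const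
      have g0 : ∀ z, 0 ≤ min (V z) (N + 1) := fun z => le_min (H.nonneg z) N0.le
      have gb : ∀ z, |min (V z) (N + 1)| ≤ N + 1 := fun z => by
        rw [abs_of_nonneg (g0 z)]; exact min_le_right _ _
      have h1 : ∀ z, |min (V z) (N + 1) / (N + 1)| ≤ 1 := fun z => by
        rw [abs_div, abs_of_pos N0]; exact (div_le_one N0).2 (gb z)
      have hle := le_of_tendsto' (hlim _ (gm.div_const _) h1) (fun n => by
        rw [integral_div]
        obtain ⟨Vi, Vle⟩ := integrable_of_lintegral_ofReal_le H.meas H.nonneg M0 (hmom (n + 1))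
        exact div_le_div_of_nonneg_right ((integral_mono (integrable_of_abs_le gm gb) Vi
          fun z => min_le_left _ _).trans Vle) N0.le)
      rw [integral_div, div_le_div_iff_of_pos_right N0] at hle
      rw [← ofReal_integral_eq_lintegral_ofReal (integrable_of_abs_le gm gb) (.of_forall g0)]
      exact ENNReal.ofReal_le_ofReal hle
    have hpt : ∀ z, liminf (fun N : ℕ => ENNReal.ofReal (min (V z) (N + 1))) atTop
        = ENNReal.ofReal (V z) := by
      intro z
      refine (tendsto_const_nhds.congr' ?_).liminf_eq
      filter_upwards [eventually_ge_atTop ⌈V z⌉₊] with N hN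
      rw [min_eq_left]
      linarith [Nat.ceil_le.1 hN]
    calc ∫⁻ z, ENNReal.ofReal (V z) ∂π
        = ∫⁻ z, liminf (fun N : ℕ => ENNReal.ofReal (min (V z) (N + 1))) atTop ∂π := by
          simp_rw [hpt]
      _ ≤ liminf (fun N : ℕ => ∫⁻ z, ENNReal.ofReal (min (V z) (N + 1)) ∂π) atTop :=
          lintegral_liminf_le fun N => (H.meas.min measurable_const).ennreal_ofReal
      _ ≤ ENNReal.ofReal M :=
          (liminf_le_liminf (.of_forall hN)).trans (by simp)
  have hπint : ∀ (μ : Measure α), IsProbabilityMeasure μ → κ.Invariant μ → ∀ h : α → ℝ,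
      Measurable h → (∀ z, |h z| ≤ 1) → ∀ n, ∫ y, ∫ z, h z ∂((κ ^ n) y) ∂μ = ∫ z, h z ∂μ := by
    intro μ _ hμ h hm h1 n
    rw [← integral_bind_kernel μ (κ ^ n) hm h1, invariant_pow hμ n]
  have herg : ∀ h : α → ℝ, Measurable h → (∀ z, |h z| ≤ 1) → ∀ n x,
      |∫ z, h z ∂((κ ^ n) x) - ∫ z, h z ∂π| ≤ ρ ^ n * (2 + β * V x + β * M) := by
    intro h hm h1 n x
    rw [← hπint π hπ hinv h hm h1 n]
    exact hmix π hπV h hm h1 n x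
  refine ⟨π, hπ, hinv, hπV, herg, fun μ hμ hμi => ext_of_integral_eq fun h hm h1 => ?_⟩
  have t1 : Tendsto (fun n => ∫ y, ∫ z, h z ∂((κ ^ n) y) ∂μ) atTop
      (𝓝 (∫ _, (∫ z, h z ∂π) ∂μ)) := by
    refine tendsto_integral_of_dominated_convergence (fun _ => 1)
      (fun n => (measurable_integral_kernel (κ ^ n) hm).aestronglyMeasurable)
      (integrable_const _)
      (fun n => .of_forall fun y => abs_integral_le_of_abs_le h1) (.of_forall fun y => ?_)
    rw [tendsto_iff_dist_tendsto_zero]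
    refine squeeze_zero (fun _ => dist_nonneg) (fun n => herg h hm h1 n y) ?_
    simpa using (tendsto_pow_atTop_nhds_zero_of_lt_one hρ hρ1).mul_const (2 + β * V y + β * M)
  simp only [hπint μ hμ hμi h hm h1, integral_const, probReal_univ, one_smul] at t1
  exact tendsto_nhds_unique tendsto_const_nhds t1

end Harris

section GaussianDensity

theorem gaussianPDFReal_one_apply (m x : ℝ) :
    gaussianPDFReal m 1 x = (√(2 * Real.pi))⁻¹ * Real.exp (-(x - m) ^ 2 / 2) := by
  simp [gaussianPDFReal]

theorem inv_sqrt_two_pi_le_one : (√(2 * Real.pi))⁻¹ ≤ 1 := by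
  refine inv_le_one_of_one_le₀ (Real.one_le_sqrt.2 ?_)
  linarith [Real.pi_gt_three]

theorem gaussianPDFReal_one_le_one (m x : ℝ) : gaussianPDFReal m 1 x ≤ 1 := by
  rw [gaussianPDFReal_one_apply]
  refine mul_le_one₀ inv_sqrt_two_pi_le_one (Real.exp_nonneg _) (Real.exp_le_one_iff.2 ?_)
  linarith [sq_nonneg (x - m)]

theorem abs_gaussianPDFReal_one_le_one (m x : ℝ) : |gaussianPDFReal m 1 x| ≤ 1 := by
  rw [abs_of_nonneg (gaussianPDFReal_nonneg _ _ _)]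
  exact gaussianPDFReal_one_le_one m x

theorem continuous_gaussianPDFReal_one (m : ℝ) : Continuous (gaussianPDFReal m 1) := by
  have : gaussianPDFReal m 1 = fun x => (√(2 * Real.pi))⁻¹ * Real.exp (-(x - m) ^ 2 / 2) :=
    funext (gaussianPDFReal_one_apply m)
  rw [this]
  fun_prop

/-- The standard Gaussian density is Lipschitz with constant one. -/
theorem abs_gaussianPDFReal_one_sub_le (m x y : ℝ) :
    |gaussianPDFReal m 1 x - gaussianPDFReal m 1 y| ≤ |x - y| := by
  set c := (√(2 * Real.pi))⁻¹
  have hc0 : 0 ≤ c := by positivity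
  have hd : ∀ u, HasDerivAt (gaussianPDFReal m 1)
      (c * (Real.exp (-(u - m) ^ 2 / 2) * (-(u - m)))) u := by
    intro u
    have : gaussianPDFReal m 1 = fun x => c * Real.exp (-(x - m) ^ 2 / 2) :=
      funext (gaussianPDFReal_one_apply m)
    rw [this]
    have h1 : HasDerivAt (fun x : ℝ => -(x - m) ^ 2 / 2) (-(u - m)) u := by
      have := ((((hasDerivAt_id u).sub_const m).pow 2).neg).div_const 2
      refine this.congr_deriv ?_
      simp only [id]
      push_cast
      ring
    exact h1.exp.const_mul c
  have hb : ∀ u ∈ (Set.univ : Set ℝ),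
      ‖c * (Real.exp (-(u - m) ^ 2 / 2) * (-(u - m)))‖ ≤ 1 := by
    intro u _
    rw [norm_mul, norm_mul, norm_neg, Real.norm_eq_abs, Real.norm_eq_abs, Real.norm_eq_abs,
      abs_of_nonneg hc0, abs_of_pos (Real.exp_pos _)]
    refine mul_le_one₀ inv_sqrt_two_pi_le_one (by positivity) ?_
    have h1 : |u - m| ≤ Real.exp ((u - m) ^ 2 / 2) := by
      refine le_trans ?_ (Real.add_one_le_exp _)
      nlinarith [sq_nonneg (|u - m| - 1), sq_abs (u - m)]
    calc Real.exp (-(u - m) ^ 2 / 2) * |u - m|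
        ≤ Real.exp (-(u - m) ^ 2 / 2) * Real.exp ((u - m) ^ 2 / 2) := by gcongr
      _ = 1 := by rw [← Real.exp_add]; ring_nf; simp
  have := convex_univ.norm_image_sub_le_of_norm_hasDerivWithin_le (𝕜 := ℝ) (C := 1)
    (fun u _ => (hd u).hasDerivWithinAt) hb (Set.mem_univ y) (Set.mem_univ x)
  simpa using this

/-- The first absolute moment of the standard Gaussian law. -/
noncomputable def absMoment : ℝ := ∫ x, |x| ∂(gaussianReal 0 1)

theorem absMoment_nonneg : 0 ≤ absMoment := integral_nonneg fun _ => abs_nonneg _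

theorem integrable_abs_gaussianReal (m : ℝ) (v : ℝ≥0) :
    Integrable (fun x => |x|) (gaussianReal m v) := by
  have := (memLp_id_gaussianReal (μ := m) (v := v) 1).integrable (by simp)
  exact this.abs

theorem integral_abs_gaussianReal_le (m : ℝ) :
    ∫ x, |x| ∂(gaussianReal m 1) ≤ |m| + absMoment := by
  have e : gaussianReal m 1 = (gaussianReal 0 1).map (fun x => m + x) := by
    rw [gaussianReal_map_const_add]; simp
  rw [e, integral_map (by fun_prop) (by fun_prop)]
  calc ∫ x, |m + x| ∂(gaussianReal 0 1) ≤ ∫ x, (|m| + |x|) ∂(gaussianReal 0 1) := by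
        refine integral_mono ?_ ?_ fun x => abs_add_le m x
        · have h : Integrable (fun x : ℝ => x) (gaussianReal 0 1) :=
            (memLp_id_gaussianReal (μ := 0) (v := 1) 1).integrable (by simp)
          exact ((integrable_const m).add h).abs
        · exact (integrable_const _).add (integrable_abs_gaussianReal 0 1)
    _ = |m| + absMoment := by
        rw [integral_add (integrable_const _) (integrable_abs_gaussianReal 0 1)]
        simp [absMoment]

end GaussianDensity

section TransitionDensity

/-- The density of the transition from `z` with respect to Lebesgue measure. -/
noncomputable def transitionDensity (ρp ρm a θ : ℝ) (z w : ℝ × ℝ) : ℝ :=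
  gaussianPDFReal (drift ρp ρm θ z.1 + z.2) 1 w.1 * gaussianPDFReal (a * z.2) 1 w.2

variable (ρp ρm a θ : ℝ)

theorem measurable_transitionDensity :
    Measurable (fun q : (ℝ × ℝ) × (ℝ × ℝ) => transitionDensity ρp ρm a θ q.1 q.2) := by
  have h := measurable_drift ρp ρm θ
  unfold transitionDensity
  simp only [gaussianPDFReal_one_apply]
  fun_prop

theorem transitionDensity_nonneg (z w : ℝ × ℝ) : 0 ≤ transitionDensity ρp ρm a θ z w :=
  mul_nonneg (gaussianPDFReal_nonneg _ _ _) (gaussianPDFReal_nonneg _ _ _)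

theorem transitionDensity_le_one (z w : ℝ × ℝ) : transitionDensity ρp ρm a θ z w ≤ 1 :=
  mul_le_one₀ (gaussianPDFReal_one_le_one _ _) (gaussianPDFReal_nonneg _ _ _)
    (gaussianPDFReal_one_le_one _ _)

theorem abs_transitionDensity_le_one (z w : ℝ × ℝ) : |transitionDensity ρp ρm a θ z w| ≤ 1 := by
  rw [abs_of_nonneg (transitionDensity_nonneg _ _ _ _ _ _)]
  exact transitionDensity_le_one _ _ _ _ _ _

theorem continuous_transitionDensity (z : ℝ × ℝ) :
    Continuous (transitionDensity ρp ρm a θ z) :=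
  ((continuous_gaussianPDFReal_one _).comp continuous_fst).mul
    ((continuous_gaussianPDFReal_one _).comp continuous_snd)

theorem transitionKernel_apply (z : ℝ × ℝ) :
    transitionKernel ρp ρm a θ z = noiseLaw.map (step ρp ρm a θ z) := rfl

theorem transitionKernel_eq_prod (z : ℝ × ℝ) :
    transitionKernel ρp ρm a θ z
      = (gaussianReal (drift ρp ρm θ z.1 + z.2) 1).prod (gaussianReal (a * z.2) 1) := by
  have e : ∀ m : ℝ, gaussianReal m 1 = (gaussianReal 0 1).map (fun x => m + x) := fun m => by
    rw [gaussianReal_map_const_add]; simp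
  rw [e (drift ρp ρm θ z.1 + z.2), e (a * z.2),
    Measure.map_prod_map _ _ (by fun_prop) (by fun_prop)]
  rfl

theorem transitionKernel_eq_densityMeasure (z : ℝ × ℝ) :
    transitionKernel ρp ρm a θ z = densityMeasure (transitionDensity ρp ρm a θ z) := by
  rw [transitionKernel_eq_prod, gaussianReal_of_var_ne_zero _ one_ne_zero,
    gaussianReal_of_var_ne_zero _ one_ne_zero,
    prod_withDensity (measurable_gaussianPDF _ _) (measurable_gaussianPDF _ _),
    ← Measure.volume_eq_prod]
  unfold densityMeasure transitionDensity
  congr 1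
  ext w
  rw [ENNReal.ofReal_mul (gaussianPDFReal_nonneg _ _ _)]
  rfl

end TransitionDensity

section Lyapunov

theorem abs_drift_le (ρp ρm θ x : ℝ) : |drift ρp ρm θ x| ≤ max |ρp| |ρm| * |x| := by
  unfold drift
  rw [abs_mul]
  gcongr
  split_ifs
  · exact le_max_left _ _
  · exact le_max_right _ _

/-- The weight of the second coordinate in the Lyapunov function. -/
noncomputable def lyapunovWeight (a : ℝ) : ℝ := 2 / (1 - |a|)

/-- The Lyapunov function `|x| + b |y|`. -/
noncomputable def lyapunov (a : ℝ) (z : ℝ × ℝ) : ℝ := |z.1| + lyapunovWeight a * |z.2|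

variable {ρp ρm a : ℝ}

theorem two_le_lyapunovWeight (ha : |a| < 1) : 2 ≤ lyapunovWeight a := by
  unfold lyapunovWeight
  rw [le_div_iff₀ (by linarith)]
  linarith [abs_nonneg a]

theorem lyapunov_nonneg (ha : |a| < 1) (z : ℝ × ℝ) : 0 ≤ lyapunov a z := by
  have := two_le_lyapunovWeight ha
  unfold lyapunov
  positivity

theorem measurable_lyapunov (a : ℝ) : Measurable (lyapunov a) := by
  unfold lyapunov
  fun_prop

theorem lyapunov_le (ha : |a| < 1) (x y : ℝ) :
    lyapunov a (x, y) ≤ lyapunovWeight a * (|x| + |y|) := by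
  have := two_le_lyapunovWeight ha
  unfold lyapunov
  nlinarith [abs_nonneg x]

/-- The contraction rate of the Lyapunov function. -/
noncomputable def lyapunovRate (ρp ρm a : ℝ) : ℝ := max (max |ρp| |ρm|) ((1 + |a|) / 2)

theorem lyapunovRate_pos : 0 < lyapunovRate ρp ρm a :=
  lt_max_of_lt_right (by positivity)

theorem lyapunovRate_lt_one (hρp : |ρp| < 1) (hρm : |ρm| < 1) (ha : |a| < 1) :
    lyapunovRate ρp ρm a < 1 :=
  max_lt (max_lt hρp hρm) (by linarith)

/-- The additive constant in the drift inequality. -/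
noncomputable def lyapunovConst (a : ℝ) : ℝ := (1 + lyapunovWeight a) * (absMoment + 1)

theorem lyapunovConst_pos (ha : |a| < 1) : 0 < lyapunovConst a := by
  have := two_le_lyapunovWeight ha
  have := absMoment_nonneg
  unfold lyapunovConst
  positivity

/-- The common mass of the minorizing measures on `{V ≤ R}`. -/
noncomputable def minorMass (R : ℝ) : ℝ :=
  ((√(2 * Real.pi))⁻¹ * Real.exp (-(1 + 2 * R) ^ 2 / 2)) ^ 2

theorem minorMass_pos (R : ℝ) : 0 < minorMass R := by
  unfold minorMass
  positivity

/-- The minorizing measure: a multiple of Lebesgue measure on the unit square. -/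
noncomputable def minorMeasure (R : ℝ) : Measure (ℝ × ℝ) :=
  (volume : Measure (ℝ × ℝ)).withDensity
    ((Set.Icc (0 : ℝ) 1 ×ˢ Set.Icc (0 : ℝ) 1).indicator fun _ => ENNReal.ofReal (minorMass R))

theorem minorMeasure_univ (R : ℝ) : minorMeasure R Set.univ = ENNReal.ofReal (minorMass R) := by
  unfold minorMeasure
  rw [withDensity_apply _ .univ, Measure.restrict_univ,
    lintegral_indicator (measurableSet_Icc.prod measurableSet_Icc), lintegral_const,
    Measure.restrict_apply_univ, Measure.volume_eq_prod, Measure.prod_prod]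
  simp

instance (R : ℝ) : IsFiniteMeasure (minorMeasure R) :=
  ⟨by rw [minorMeasure_univ]; exact ENNReal.ofReal_lt_top⟩

theorem minorMeasure_real_univ (R : ℝ) : (minorMeasure R).real Set.univ = minorMass R := by
  rw [measureReal_def, minorMeasure_univ, ENNReal.toReal_ofReal (minorMass_pos R).le]

theorem le_gaussianPDFReal_one {R m x : ℝ} (hm : |m| ≤ 2 * R) (hx : x ∈ Set.Icc (0 : ℝ) 1) :
    (√(2 * Real.pi))⁻¹ * Real.exp (-(1 + 2 * R) ^ 2 / 2) ≤ gaussianPDFReal m 1 x := by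
  rw [gaussianPDFReal_one_apply]
  have h : |x - m| ≤ |1 + 2 * R| := by
    have := abs_sub x m
    rw [abs_of_nonneg hx.1] at this
    exact le_trans (by linarith [hx.2]) (le_abs_self _)
  have := sq_le_sq.2 h
  gcongr

theorem driftMinorization (hρp : |ρp| < 1) (hρm : |ρm| < 1) (ha : |a| < 1) (θ R : ℝ) :
    DriftMinorization (transitionKernel ρp ρm a θ) (lyapunov a) (lyapunovRate ρp ρm a)
      (lyapunovConst a) R (minorMeasure R) := by
  have hb := two_le_lyapunovWeight ha
  have hm0 := absMoment_nonneg
  have i1 : ∀ z, Integrable (fun w : ℝ × ℝ => |w.1|) (transitionKernel ρp ρm a θ z) := fun z => by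
    rw [transitionKernel_eq_prod]
    exact (integrable_abs_gaussianReal _ _).comp_fst _
  have i2 : ∀ z, Integrable (fun w : ℝ × ℝ => |w.2|) (transitionKernel ρp ρm a θ z) := fun z => by
    rw [transitionKernel_eq_prod]
    exact (integrable_abs_gaussianReal _ _).comp_snd _
  refine ⟨measurable_lyapunov a, lyapunov_nonneg ha, fun z => (i1 z).add ((i2 z).const_mul _),
    fun z => ?_, fun z hz => ?_⟩
  · have e : ∫ w, lyapunov a w ∂(transitionKernel ρp ρm a θ z)
        = ∫ x, |x| ∂(gaussianReal (drift ρp ρm θ z.1 + z.2) 1)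
          + lyapunovWeight a * ∫ x, |x| ∂(gaussianReal (a * z.2) 1) := by
      unfold lyapunov
      rw [integral_add (i1 z) ((i2 z).const_mul _), integral_const_mul, transitionKernel_eq_prod,
        integral_fun_fst (fun x : ℝ => |x|), integral_fun_snd (fun x : ℝ => |x|)]
      simp
    rw [e]
    have h1 := integral_abs_gaussianReal_le (drift ρp ρm θ z.1 + z.2)
    have h2 := mul_le_mul_of_nonneg_left (integral_abs_gaussianReal_le (a * z.2))
      (show 0 ≤ lyapunovWeight a by linarith)
    have h3 := abs_add_le (drift ρp ρm θ z.1) z.2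
    have h4 := abs_drift_le ρp ρm θ z.1
    rw [abs_mul] at h2
    have h5 : max |ρp| |ρm| * |z.1| ≤ lyapunovRate ρp ρm a * |z.1| :=
      mul_le_mul_of_nonneg_right (le_max_left _ _) (abs_nonneg _)
    have h6 : 1 + lyapunovWeight a * |a| ≤ lyapunovRate ρp ρm a * lyapunovWeight a := by
      have : lyapunovWeight a * (1 - |a|) = 2 := by
        unfold lyapunovWeight
        exact div_mul_cancel₀ _ (by linarith)
      have h7 : (1 + |a|) / 2 * lyapunovWeight a ≤ lyapunovRate ρp ρm a * lyapunovWeight a :=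
        mul_le_mul_of_nonneg_right (le_max_right _ _) (by linarith)
      linarith
    have h8 := mul_le_mul_of_nonneg_right h6 (abs_nonneg z.2)
    unfold lyapunov lyapunovConst
    nlinarith
  · rw [transitionKernel_eq_densityMeasure]
    refine withDensity_mono (.of_forall fun w => ?_)
    by_cases hw : w ∈ Set.Icc (0 : ℝ) 1 ×ˢ Set.Icc (0 : ℝ) 1
    · rw [Set.indicator_of_mem hw]
      refine ENNReal.ofReal_le_ofReal ?_
      unfold minorMass transitionDensity
      rw [sq]
      unfold lyapunov at hz
      have hz2 : |z.2| ≤ R - |z.1| := by nlinarith [abs_nonneg z.2]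
      have hz1 := abs_nonneg z.1
      have hz3 := abs_nonneg z.2
      have hρ : max |ρp| |ρm| ≤ 1 := max_le hρp.le hρm.le
      refine mul_le_mul (le_gaussianPDFReal_one ?_ hw.1) (le_gaussianPDFReal_one ?_ hw.2)
        (by positivity) (gaussianPDFReal_nonneg _ _ _)
      · have h3 := abs_add_le (drift ρp ρm θ z.1) z.2
        have h4 := abs_drift_le ρp ρm θ z.1
        nlinarith
      · rw [abs_mul]
        nlinarith
    · rw [Set.indicator_of_notMem hw]
      exact zero_le

end Lyapunov

section StationaryDensity

variable {ρp ρm a θ : ℝ}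

/-- The density `w ↦ ∫ q(z, w) π(dz)` of one step of the chain started from `π`. -/
noncomputable def stationaryDensity (ρp ρm a θ : ℝ) (π : Measure (ℝ × ℝ)) (w : ℝ × ℝ) : ℝ :=
  ∫ z, transitionDensity ρp ρm a θ z w ∂π

theorem measurable_transitionDensity_left (w : ℝ × ℝ) :
    Measurable fun z => transitionDensity ρp ρm a θ z w := by
  have h := measurable_drift ρp ρm θ
  unfold transitionDensity
  simp only [gaussianPDFReal_one_apply]
  fun_prop

variable (π : Measure (ℝ × ℝ)) [IsProbabilityMeasure π]

theorem integrable_transitionDensity (w : ℝ × ℝ) :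
    Integrable (fun z => transitionDensity ρp ρm a θ z w) π :=
  integrable_of_abs_le (measurable_transitionDensity_left w) fun z => abs_transitionDensity_le_one _ _ _ _ z w

theorem continuous_stationaryDensity : Continuous (stationaryDensity ρp ρm a θ π) := by
  refine continuous_of_dominated (bound := fun _ => 1)
    (fun w => (integrable_transitionDensity π w).aestronglyMeasurable)
    (fun w => .of_forall fun z => abs_transitionDensity_le_one _ _ _ _ z w)
    (integrable_const _) (.of_forall fun z => continuous_transitionDensity _ _ _ _ z)

theorem stationaryDensity_nonneg (π : Measure (ℝ × ℝ)) (w : ℝ × ℝ) : 0 ≤ stationaryDensity ρp ρm a θ π w :=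
  integral_nonneg fun z => transitionDensity_nonneg _ _ _ _ z w

theorem stationaryDensity_le_one (w : ℝ × ℝ) : stationaryDensity ρp ρm a θ π w ≤ 1 :=
  (le_abs_self _).trans
    (abs_integral_le_of_abs_le fun z => abs_transitionDensity_le_one _ _ _ _ z w)

variable {π}

theorem densityMeasure_stationaryDensity (h : (transitionKernel ρp ρm a θ).Invariant π) :
    densityMeasure (stationaryDensity ρp ρm a θ π) = π := by
  ext s hs
  conv_rhs => rw [← h.def]
  rw [Measure.bind_apply hs (Kernel.aemeasurable _)]
  simp_rw [transitionKernel_eq_densityMeasure, densityMeasure]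
  rw [withDensity_apply _ hs]
  simp_rw [withDensity_apply _ hs]
  rw [lintegral_lintegral_swap (measurable_transitionDensity ρp ρm a θ).ennreal_ofReal.aemeasurable]
  refine lintegral_congr fun w => ?_
  exact ofReal_integral_eq_lintegral_ofReal (integrable_transitionDensity π w)
    (.of_forall fun z => transitionDensity_nonneg _ _ _ _ z w)

variable (π)

theorem integrable_prod_transitionDensity (x : ℝ) :
    Integrable (fun q : ℝ × (ℝ × ℝ) => transitionDensity ρp ρm a θ q.2 (x, q.1))
      (volume.prod π) := by
  have hm : Measurable (fun q : ℝ × (ℝ × ℝ) => transitionDensity ρp ρm a θ q.2 (x, q.1)) := by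
    have h := measurable_drift ρp ρm θ
    unfold transitionDensity
    simp only [gaussianPDFReal_one_apply]
    fun_prop
  rw [integrable_prod_iff' hm.aestronglyMeasurable]
  refine ⟨.of_forall fun z => by
    simpa only [transitionDensity] using (integrable_gaussianPDFReal _ _).const_mul _, ?_⟩
  have e : (fun z => ∫ y, ‖transitionDensity ρp ρm a θ z (x, y)‖)
      = fun z => gaussianPDFReal (drift ρp ρm θ z.1 + z.2) 1 x := by
    ext z
    simp_rw [Real.norm_of_nonneg (transitionDensity_nonneg ρp ρm a θ z _)]
    unfold transitionDensity
    simp only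
    rw [integral_const_mul, integral_gaussianPDFReal_eq_one _ one_ne_zero, mul_one]
  rw [e]
  refine integrable_of_abs_le ?_ fun z => abs_gaussianPDFReal_one_le_one _ x
  have h := measurable_drift ρp ρm θ
  simp only [gaussianPDFReal_one_apply]
  fun_prop

theorem integrable_stationaryDensity_snd (x : ℝ) :
    Integrable fun y => stationaryDensity ρp ρm a θ π (x, y) :=
  (integrable_prod_transitionDensity π x).integral_prod_left

theorem integral_stationaryDensity_snd (x : ℝ) :
    ∫ y, stationaryDensity ρp ρm a θ π (x, y)
      = ∫ z, gaussianPDFReal (drift ρp ρm θ z.1 + z.2) 1 x ∂π := by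
  unfold stationaryDensity
  rw [integral_integral_swap (f := fun y z => transitionDensity ρp ρm a θ z (x, y))
    (integrable_prod_transitionDensity π x)]
  unfold transitionDensity
  simp only [integral_const_mul, integral_gaussianPDFReal_eq_one _ one_ne_zero, mul_one]

theorem abs_integral_stationaryDensity_snd_sub_le (x x' : ℝ) :
    |(∫ y, stationaryDensity ρp ρm a θ π (x, y)) - ∫ y, stationaryDensity ρp ρm a θ π (x', y)|
      ≤ |x - x'| := by
  have hi : ∀ u : ℝ,
      Integrable (fun z : ℝ × ℝ => gaussianPDFReal (drift ρp ρm θ z.1 + z.2) 1 u) π := by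
    intro u
    refine integrable_of_abs_le ?_ fun z => abs_gaussianPDFReal_one_le_one _ u
    have h := measurable_drift ρp ρm θ
    simp only [gaussianPDFReal_one_apply]
    fun_prop
  rw [integral_stationaryDensity_snd, integral_stationaryDensity_snd, ← integral_sub (hi x) (hi x')]
  exact abs_integral_le_of_abs_le fun z => abs_gaussianPDFReal_one_sub_le _ x x'

end StationaryDensity

/-- The integral of a 1-Lipschitz function over a short interval. -/
theorem abs_setIntegral_Icc_sub_le {g : ℝ → ℝ} (hg : ∀ x y, |g x - g y| ≤ |x - y|) (θ : ℝ) {l : ℝ}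
    (hl : 0 ≤ l) : |(∫ x in Set.Icc θ (θ + l), g x) - l * g θ| ≤ l ^ 2 := by
  have hc : Continuous g := LipschitzWith.continuous (K := 1) <|
    LipschitzWith.of_dist_le_mul fun x y => by simpa [Real.dist_eq] using hg x y
  have hvol : (volume : Measure ℝ).real (Set.Icc θ (θ + l)) = l := by
    rw [Real.volume_real_Icc]; simp [hl]
  have e : (∫ x in Set.Icc θ (θ + l), g x) - l * g θ
      = ∫ x in Set.Icc θ (θ + l), (g x - g θ) := by
    rw [integral_sub (hc.integrableOn_Icc) (integrable_const _)]
    simp [hvol]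
  rw [e, ← Real.norm_eq_abs]
  refine (norm_setIntegral_le_of_norm_le_const (C := l) (by simp) fun x hx => ?_).trans ?_
  · refine (hg x θ).trans ?_
    rw [abs_of_nonneg (by linarith [hx.1])]
    linarith [hx.2]
  · rw [hvol, sq]

theorem exists_stationaryDensity {ρp ρm a : ℝ} (hρp : |ρp| < 1) (hρm : |ρm| < 1) (ha : |a| < 1) :
    ∃ C r M : ℝ, 0 < C ∧ 0 < r ∧ r < 1 ∧ 0 ≤ M ∧
      lyapunovRate ρp ρm a * M + lyapunovConst a ≤ M ∧ ∀ θ : ℝ, ∃ p : ℝ × ℝ → ℝ,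
        Continuous p ∧ (∀ z, 0 ≤ p z ∧ p z ≤ 1) ∧ IsProbabilityMeasure (densityMeasure p) ∧
        (transitionKernel ρp ρm a θ).Invariant (densityMeasure p) ∧
        (∀ μ : Measure (ℝ × ℝ), IsProbabilityMeasure μ →
          (transitionKernel ρp ρm a θ).Invariant μ → μ = densityMeasure p) ∧
        (∀ x, Integrable (fun y => p (x, y))) ∧
        (∀ x x', |(∫ y, p (x, y)) - ∫ y, p (x', y)| ≤ |x - x'|) ∧
        (∀ (n : ℕ) (h : ℝ × ℝ → ℝ), Measurable h → (∀ z, |h z| ≤ 1) → ∀ x y : ℝ,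
          |(∫ z, h z ∂((transitionKernel ρp ρm a θ ^ n) (x, y)))
              - ∫ z, h z ∂(densityMeasure p)| ≤ C * r ^ n * (1 + |x| + |y|)) ∧
        ∫⁻ z, ENNReal.ofReal (lyapunov a z) ∂(densityMeasure p) ≤ ENNReal.ofReal M := by
  have hl0 : 0 < lyapunovRate ρp ρm a := lyapunovRate_pos
  have hl1 := lyapunovRate_lt_one hρp hρm ha
  have hK := lyapunovConst_pos ha
  have hb := two_le_lyapunovWeight ha
  have h1l : 0 < 1 - lyapunovRate ρp ρm a := by linarith
  set R := 4 * lyapunovConst a / (1 - lyapunovRate ρp ρm a) with hR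
  set M := lyapunovConst a / (1 - lyapunovRate ρp ρm a) with hM
  have hMe : (1 - lyapunovRate ρp ρm a) * M = lyapunovConst a := mul_div_cancel₀ _ h1l.ne'
  have hM0 : 0 ≤ M := by positivity
  have hM1 : lyapunovRate ρp ρm a * M + lyapunovConst a ≤ M := by linarith
  obtain ⟨β, r, hβ, hr0, hr1, hfar, hnear⟩ := exists_contraction_constants (R := R) hl0 hl1 hK
    (mul_div_cancel₀ _ h1l.ne').ge (minorMass_pos R)
  refine ⟨2 + β * lyapunovWeight a + β * M, r, M, by positivity, hr0, hr1, hM0, hM1, fun θ => ?_⟩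
  have H := driftMinorization hρp hρm ha θ R
  rw [← minorMeasure_real_univ R] at hnear
  obtain ⟨π, hπ, hinv, hV, herg, huniq⟩ := H.exists_invariant hl0.le hK.le hβ.le hr0.le hr1 hfar
    hnear (vol := volume) (fun z => by
      rw [transitionKernel_eq_densityMeasure]
      exact withDensity_absolutelyContinuous _ _) (x₀ := (0, 0)) (M := M)
    (by simpa [lyapunov] using hM0) hM1
  have hd := densityMeasure_stationaryDensity hinv
  refine ⟨stationaryDensity ρp ρm a θ π, continuous_stationaryDensity π,
    fun z => ⟨stationaryDensity_nonneg π z, stationaryDensity_le_one π z⟩, hd.symm ▸ hπ,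
    hd.symm ▸ hinv, fun μ h1 h2 => hd.symm ▸ huniq μ h1 h2, integrable_stationaryDensity_snd π,
    abs_integral_stationaryDensity_snd_sub_le π, fun n h hm h1 x y => ?_, hd.symm ▸ hV⟩
  rw [hd]
  refine (herg h hm h1 n (x, y)).trans ?_
  rw [mul_comm _ (r ^ n), mul_assoc]
  refine mul_le_mul_of_nonneg_left ?_ (pow_nonneg hr0.le n)
  have h2 := mul_le_mul_of_nonneg_left (lyapunov_le ha x y) hβ.le
  have h3 : 0 ≤ β * M := by positivity
  nlinarith [abs_nonneg x, abs_nonneg y, mul_nonneg h3 (abs_nonneg x),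
    mul_nonneg h3 (abs_nonneg y), mul_nonneg hβ.le (show 0 ≤ lyapunovWeight a by linarith)]

section CondExp

variable {Ω α β : Type*} [MeasurableSpace α] [MeasurableSpace β]

/-- The conditional expectation of a function of a known and of an independent variable. -/
theorem condExp_of_indep {m mΩ : MeasurableSpace Ω} (hm : m ≤ mΩ) {P : Measure Ω}
    [IsProbabilityMeasure P] {U : Ω → α} (hU : Measurable[m] U) {T : Ω → β} (hT : Measurable T)
    (hind : Indep m (MeasurableSpace.comap T inferInstance) P) {Ψ : α × β → ℝ}
    (hΨ : Measurable Ψ) {M : ℝ} (hM : ∀ q, |Ψ q| ≤ M) :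
    P[fun ω => Ψ (U ω, T ω) | m] =ᵐ[P] fun ω => ∫ t, Ψ (U ω, t) ∂(P.map T) := by
  have hU' : Measurable U := hU.mono hm le_rfl
  have : IsProbabilityMeasure (P.map T) := Measure.isProbabilityMeasure_map hT.aemeasurable
  have hin : Measurable fun u => ∫ t, Ψ (u, t) ∂(P.map T) :=
    hΨ.stronglyMeasurable.integral_prod_right'.measurable
  have hinb : ∀ u, |∫ t, Ψ (u, t) ∂(P.map T)| ≤ M := fun u =>
    abs_integral_le_of_abs_le fun t => hM (u, t)
  symm
  refine ae_eq_condExp_of_forall_setIntegral_eq hm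
    (integrable_of_abs_le (hΨ.comp (hU'.prodMk hT)) fun ω => hM _)
    (fun s _ _ => (integrable_of_abs_le (hin.comp hU') fun ω => hinb _).integrableOn)
    (fun s hs _ => ?_) (hin.comp hU).aestronglyMeasurable
  set V : Ω → α × ℝ := fun ω => (U ω, s.indicator (fun _ => 1) ω) with hV
  have hVm : Measurable[m] V := hU.prodMk (measurable_const.indicator hs)
  have hV' : Measurable V := hVm.mono hm le_rfl
  have hI : IndepFun V T P := indep_of_indep_of_le_left hind hVm.comap_le
  have hprod := hI.map_prod_eq_prod_map_map hV'.aemeasurable hT.aemeasurable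
  have : IsProbabilityMeasure (P.map V) := Measure.isProbabilityMeasure_map hV'.aemeasurable
  set F : (α × ℝ) × β → ℝ := fun q => max 0 (min 1 q.1.2) * Ψ (q.1.1, q.2) with hF
  have hFm : Measurable F := by
    have : Measurable fun q : (α × ℝ) × β => Ψ (q.1.1, q.2) := hΨ.comp (by fun_prop)
    exact ((measurable_const.max (measurable_const.min (by fun_prop)))).mul this
  have hFb : ∀ q, |F q| ≤ M := fun q => by
    rw [hF, abs_mul]
    have h1 : |max 0 (min 1 q.1.2)| ≤ 1 := by
      rw [abs_of_nonneg (le_max_left _ _)]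
      exact max_le zero_le_one (min_le_left _ _)
    exact (mul_le_of_le_one_left (abs_nonneg _) h1).trans (hM _)
  have hs' := hm s hs
  have e1 : ∫ ω in s, Ψ (U ω, T ω) ∂P = ∫ q, F q ∂(P.map fun ω => (V ω, T ω)) := by
    rw [integral_map (hV'.prodMk hT).aemeasurable hFm.aestronglyMeasurable,
      ← integral_indicator hs']
    refine integral_congr_ae (.of_forall fun ω => ?_)
    by_cases hω : ω ∈ s <;> simp [hF, hV, hω]
  rw [e1, hprod, integral_prod _ (integrable_of_abs_le hFm hFb),
    integral_map hV'.aemeasurable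
      hFm.stronglyMeasurable.integral_prod_right'.aestronglyMeasurable,
    ← integral_indicator hs']
  refine integral_congr_ae (.of_forall fun ω => ?_)
  by_cases hω : ω ∈ s <;> simp [hF, hV, hω]

end CondExp

section ChangeOfMeasure

open ENNReal

variable {Ω β : Type*} [MeasurableSpace Ω] [MeasurableSpace β] {P : Measure Ω} {W : ℕ → Ω → β}
  {g : β → ℝ≥0∞}

theorem withDensity_iInter_preimage (hW : ∀ i, Measurable (W i)) (hind : iIndepFun W P)
    (hg : Measurable g) (hg1 : ∫⁻ ω, g (W 0 ω) ∂P = 1) (S : Finset ℕ) {A : ℕ → Set β}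
    (hA : ∀ i, MeasurableSet (A i)) :
    (P.withDensity fun ω => g (W 0 ω)) (⋂ i ∈ S, W i ⁻¹' A i)
      = ∏ i ∈ S, ∫⁻ ω, (if i = 0 then g (W i ω) else 1) * (A i).indicator 1 (W i ω) ∂P := by
  classical
  have key : ∀ (S : Finset ℕ) (A : ℕ → Set β), 0 ∈ S → (∀ i, MeasurableSet (A i)) →
      (P.withDensity fun ω => g (W 0 ω)) (⋂ i ∈ S, W i ⁻¹' A i)
        = ∏ i ∈ S, ∫⁻ ω, (if i = 0 then g (W i ω) else 1) * (A i).indicator 1 (W i ω) ∂P := by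
    intro S A h0 hA
    have hms : MeasurableSet (⋂ i ∈ S, W i ⁻¹' A i) :=
      Finset.measurableSet_biInter S fun i _ => hW i (hA i)
    have hφ : ∀ i, Measurable fun b =>
        (if i = 0 then g b else 1) * (A i).indicator (1 : β → ℝ≥0∞) b := by
      intro i
      refine Measurable.mul ?_ (measurable_one.indicator (hA i))
      split_ifs
      · exact hg
      · exact measurable_const
    have hI := hind.comp _ hφ
    rw [withDensity_apply _ hms, ← lintegral_indicator hms]
    have e := lintegral_prod_eq_prod_lintegral_of_indepFun S _ hI fun i => (hφ i).comp (hW i)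
    simp only [Function.comp_apply] at e
    rw [← e]
    refine lintegral_congr fun ω => ?_
    rw [Finset.prod_mul_distrib, Finset.prod_ite_eq' S 0 (fun i => g (W i ω)), if_pos h0]
    by_cases hω : ω ∈ ⋂ i ∈ S, W i ⁻¹' A i
    · rw [Set.indicator_of_mem hω, Finset.prod_eq_one, mul_one]
      intro i hi
      have hi' : W i ω ∈ A i := Set.mem_iInter₂.1 hω i hi
      exact Set.indicator_of_mem hi' _
    · rw [Set.indicator_of_notMem hω]
      obtain ⟨i, hi, hiA⟩ : ∃ i ∈ S, W i ω ∉ A i := by simpa using hω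
      rw [Finset.prod_eq_zero hi (Set.indicator_of_notMem hiA _), mul_zero]
  by_cases h0 : 0 ∈ S
  · exact key S A h0 hA
  · have hA' : ∀ i, MeasurableSet (Function.update A 0 Set.univ i) := fun i => by
      rcases eq_or_ne i 0 with rfl | hi
      · simp
      · simpa [Function.update_of_ne hi] using hA i
    have hne : ∀ i ∈ S, i ≠ 0 := fun i hi h => h0 (h ▸ hi)
    have h := key (insert 0 S) (Function.update A 0 Set.univ) (Finset.mem_insert_self _ _) hA'
    rw [Finset.prod_insert h0, Finset.set_biInter_insert] at h
    simp only [Function.update_self, Set.preimage_univ, Set.univ_inter, if_true,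
      Set.indicator_univ, Pi.one_apply, mul_one, hg1, one_mul] at h
    have e1 : ⋂ i ∈ S, W i ⁻¹' Function.update A 0 Set.univ i = ⋂ i ∈ S, W i ⁻¹' A i :=
      Set.iInter₂_congr fun i hi => by rw [Function.update_of_ne (hne i hi)]
    rw [e1] at h
    rw [h]
    exact Finset.prod_congr rfl fun i hi => by rw [Function.update_of_ne (hne i hi)]

theorem withDensity_preimage (hW : ∀ i, Measurable (W i)) (hind : iIndepFun W P)
    (hg : Measurable g) (hg1 : ∫⁻ ω, g (W 0 ω) ∂P = 1) (i : ℕ) {A : Set β}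
    (hA : MeasurableSet A) :
    (P.withDensity fun ω => g (W 0 ω)) (W i ⁻¹' A)
      = ∫⁻ ω, (if i = 0 then g (W i ω) else 1) * A.indicator 1 (W i ω) ∂P := by
  simpa using withDensity_iInter_preimage hW hind hg hg1 {i} (A := fun _ => A) fun _ => hA

/-- Tilting the law of the first of a sequence of independent variables keeps independence. -/
theorem iIndepFun_withDensity (hW : ∀ i, Measurable (W i)) (hind : iIndepFun W P)
    (hg : Measurable g) (hg1 : ∫⁻ ω, g (W 0 ω) ∂P = 1) :
    iIndepFun W (P.withDensity fun ω => g (W 0 ω)) := by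
  classical
  rw [iIndepFun_iff_measure_inter_preimage_eq_mul]
  intro S A hA
  set A' : ℕ → Set β := fun i => if i ∈ S then A i else Set.univ with hA'
  have e : ∀ i ∈ S, A' i = A i := fun i hi => if_pos hi
  have hm : ∀ i, MeasurableSet (A' i) := fun i => by
    simp only [hA']
    split_ifs with h
    · exact hA i h
    · exact MeasurableSet.univ
  have e1 : ⋂ i ∈ S, W i ⁻¹' A i = ⋂ i ∈ S, W i ⁻¹' A' i :=
    Set.iInter₂_congr fun i hi => by rw [e i hi]
  rw [e1, withDensity_iInter_preimage hW hind hg hg1 S hm]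
  refine Finset.prod_congr rfl fun i hi => ?_
  rw [e i hi, withDensity_preimage hW hind hg hg1 i (hA i hi)]

theorem map_withDensity_of_ne_zero (hW : ∀ i, Measurable (W i)) (hind : iIndepFun W P)
    (hg : Measurable g) (hg1 : ∫⁻ ω, g (W 0 ω) ∂P = 1) {i : ℕ} (hi : i ≠ 0) :
    (P.withDensity fun ω => g (W 0 ω)).map (W i) = P.map (W i) := by
  ext A hA
  rw [Measure.map_apply (hW i) hA, Measure.map_apply (hW i) hA,
    withDensity_preimage hW hind hg hg1 i hA]
  simp only [hi, if_false, one_mul]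
  rw [← lintegral_indicator_one (hW i hA)]
  rfl

end ChangeOfMeasure

section Noise

variable {Ω : Type*} {X ξ ε ζ : ℕ → Ω → ℝ}

theorem past_eq (ε ζ : ℕ → Ω → ℝ) (k : ℕ) :
    past ε ζ k = ⨆ i ∈ {i : ℕ | i ≤ k},
      MeasurableSpace.comap (fun ω => (ε i ω, ζ i ω)) inferInstance := by
  unfold past
  refine iSup_congr fun i => iSup_congr fun _ => ?_
  exact (MeasurableSpace.comap_prodMk (ε i) (ζ i)).symm

theorem past_mono (ε ζ : ℕ → Ω → ℝ) {k l : ℕ} (h : k ≤ l) : past ε ζ k ≤ past ε ζ l :=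
  iSup_mono fun _ => iSup_mono' fun hi => ⟨hi.trans h, le_rfl⟩

theorem measurable_noise_past (ε ζ : ℕ → Ω → ℝ) {i k : ℕ} (h : i ≤ k) :
    Measurable[past ε ζ k] fun ω => (ε i ω, ζ i ω) := by
  rw [measurable_iff_comap_le, past_eq]
  exact le_iSup₂_of_le i h le_rfl

end Noise

namespace IsModel

variable {Ω : Type*} [MeasurableSpace Ω] {ρp ρm a θ : ℝ} {μ₀ : Measure (ℝ × ℝ)}
  {X ξ ε ζ : ℕ → Ω → ℝ} {P : Measure Ω}

theorem measurable_noise (hm : IsModel ρp ρm a θ μ₀ X ξ ε ζ P) (j : ℕ) :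
    Measurable fun ω => (ε j ω, ζ j ω) := (hm.meas_ε j).prodMk (hm.meas_ζ j)

theorem past_le (hm : IsModel ρp ρm a θ μ₀ X ξ ε ζ P) (k : ℕ) :
    past ε ζ k ≤ (inferInstance : MeasurableSpace Ω) :=
  iSup₂_le fun i _ => sup_le (hm.meas_ε i).comap_le (hm.meas_ζ i).comap_le

theorem state_succ (hm : IsModel ρp ρm a θ μ₀ X ξ ε ζ P) (k : ℕ) (ω : Ω) :
    (X (k + 1) ω, ξ (k + 1) ω)
      = step ρp ρm a θ (X k ω, ξ k ω) (ε (k + 1) ω, ζ (k + 1) ω) := by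
  rw [hm.rec_X, hm.rec_ξ]
  rfl

theorem measurable_state_past (hm : IsModel ρp ρm a θ μ₀ X ξ ε ζ P) (k : ℕ) :
    Measurable[past ε ζ k] fun ω => (X k ω, ξ k ω) := by
  induction k with
  | zero => exact hm.init_X.prodMk hm.init_ξ
  | succ k ih =>
    simp_rw [hm.state_succ]
    exact (measurable_step ρp ρm a θ).comp
      ((ih.mono (past_mono ε ζ k.le_succ) le_rfl).prodMk (measurable_noise_past ε ζ le_rfl))

theorem measurable_state (hm : IsModel ρp ρm a θ μ₀ X ξ ε ζ P) (k : ℕ) :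
    Measurable fun ω => (X k ω, ξ k ω) :=
  (hm.measurable_state_past k).mono (hm.past_le k) le_rfl

theorem measurable_tail (hm : IsModel ρp ρm a θ μ₀ X ξ ε ζ P) (k : ℕ) :
    Measurable fun ω (i : ℕ) => (ε (k + 1 + i) ω, ζ (k + 1 + i) ω) :=
  measurable_pi_lambda _ fun i => hm.measurable_noise (k + 1 + i)

/-- The noises after time `k` are independent of the past until time `k`. -/
theorem indep_past_tail (hm : IsModel ρp ρm a θ μ₀ X ξ ε ζ P) (k : ℕ) :
    Indep (past ε ζ k) (MeasurableSpace.comap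
      (fun ω (i : ℕ) => (ε (k + 1 + i) ω, ζ (k + 1 + i) ω)) inferInstance) P := by
  have h := indep_iSup_of_disjoint (fun i => (hm.measurable_noise i).comap_le) hm.indep.iIndep
    (S := {i : ℕ | i ≤ k}) (T := {i : ℕ | k < i})
    (Set.disjoint_left.2 fun i (h1 : i ≤ k) (h2 : k < i) => absurd h1 (not_le.2 h2))
  rw [← past_eq] at h
  refine indep_of_indep_of_le_right h ?_
  rw [← measurable_iff_comap_le]
  refine @measurable_pi_lambda Ω ℕ (fun _ => ℝ × ℝ) (_) _ _ fun i => ?_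
  rw [measurable_iff_comap_le]
  exact le_iSup₂_of_le (f := fun (i : ℕ) (_ : i ∈ {i : ℕ | k < i}) =>
      MeasurableSpace.comap (fun ω => (ε i ω, ζ i ω)) inferInstance) (k + 1 + i)
    (show k < k + 1 + i by omega) le_rfl

theorem indep_past_noise (hm : IsModel ρp ρm a θ μ₀ X ξ ε ζ P) (k : ℕ) :
    Indep (past ε ζ k) (MeasurableSpace.comap
      (fun ω => (ε (k + 1) ω, ζ (k + 1) ω)) inferInstance) P := by
  refine indep_of_indep_of_le_right (hm.indep_past_tail k) ?_
  rw [← measurable_iff_comap_le]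
  have h0 : Measurable fun t : ℕ → ℝ × ℝ => t 0 := measurable_pi_apply 0
  exact h0.comp (comap_measurable _)

theorem map_tail (hm : IsModel ρp ρm a θ μ₀ X ξ ε ζ P) (k : ℕ) :
    P.map (fun ω (i : ℕ) => (ε (k + 1 + i) ω, ζ (k + 1 + i) ω))
      = Measure.infinitePi fun _ : ℕ => noiseLaw := by
  have hi := hm.indep.precomp (g := fun i : ℕ => k + 1 + i) (add_right_injective (k + 1))
  rw [hi.map_fun_eq_infinitePi_map fun i => hm.measurable_noise (k + 1 + i)]
  congr 1
  ext1 i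
  exact hm.noise_law (k + 1 + i) (by omega)

theorem condExp_succ (hm : IsModel ρp ρm a θ μ₀ X ξ ε ζ P) (k : ℕ) {h : ℝ × ℝ → ℝ}
    (hh : Measurable h) (h1 : ∀ z, |h z| ≤ 1) :
    P[fun ω => h (X (k + 1) ω, ξ (k + 1) ω) | past ε ζ k]
      =ᵐ[P] fun ω => ∫ z, h z ∂(transitionKernel ρp ρm a θ (X k ω, ξ k ω)) := by
  have := hm.isProb
  have key := condExp_of_indep (hm.past_le k) (P := P) (hm.measurable_state_past k)
    (hm.measurable_noise (k + 1)) (hm.indep_past_noise k)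
    (Ψ := fun q => h (step ρp ρm a θ q.1 q.2)) (hh.comp (measurable_step ρp ρm a θ))
    (fun q => h1 _)
  simp_rw [hm.state_succ]
  refine key.trans (.of_forall fun ω => ?_)
  have hs : Measurable (step ρp ρm a θ (X k ω, ξ k ω)) :=
    (measurable_step ρp ρm a θ).comp measurable_prodMk_left
  simp only
  rw [hm.noise_law (k + 1) (by omega), transitionKernel_apply,
    integral_map hs.aemeasurable hh.aestronglyMeasurable]

theorem isMarkovChain (hm : IsModel ρp ρm a θ μ₀ X ξ ε ζ P) :
    IsMarkovChain (transitionKernel ρp ρm a θ) X ξ ε ζ P := by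
  have := hm.isProb
  intro k n
  induction n with
  | zero =>
    intro h hh h1
    simp_rw [integral_pow_zero _ hh]
    have hs : Measurable[past ε ζ k] fun ω => h (X k ω, ξ k ω) :=
      hh.comp (hm.measurable_state_past k)
    rw [add_zero, condExp_of_stronglyMeasurable (hm.past_le k) hs.stronglyMeasurable
      (integrable_of_abs_le (hs.mono (hm.past_le k) le_rfl) fun ω => h1 _)]
  | succ n ih =>
    intro h hh h1
    have e1 := (condExp_condExp_of_le (f := fun ω => h (X (k + (n + 1)) ω, ξ (k + (n + 1)) ω))
      (μ := P) (past_mono ε ζ (Nat.le_add_right k n)) (hm.past_le (k + n))).symm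
    have e2 := condExp_congr_ae (m := past ε ζ k) (hm.condExp_succ (k + n) hh h1)
    have e3 := ih _ (measurable_integral_kernel (transitionKernel ρp ρm a θ) hh)
      fun z => abs_integral_le_of_abs_le h1
    refine e1.trans (e2.trans (e3.trans (.of_forall fun ω => ?_)))
    simp only
    rw [add_comm n 1, integral_pow_add _ hh h1, pow_one]

theorem integral_state_add (hm : IsModel ρp ρm a θ μ₀ X ξ ε ζ P) (k n : ℕ) {h : ℝ × ℝ → ℝ}
    (hh : Measurable h) (h1 : ∀ z, |h z| ≤ 1) :
    ∫ ω, h (X (k + n) ω, ξ (k + n) ω) ∂P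
      = ∫ ω, (∫ z, h z ∂((transitionKernel ρp ρm a θ ^ n) (X k ω, ξ k ω))) ∂P := by
  have := hm.isProb
  rw [← integral_condExp (hm.past_le k), integral_congr_ae (hm.isMarkovChain k n h hh h1)]

theorem isProbabilityMeasure_map (hm : IsModel ρp ρm a θ μ₀ X ξ ε ζ P) (k : ℕ) :
    IsProbabilityMeasure (P.map fun ω => (X k ω, ξ k ω)) :=
  have := hm.isProb
  Measure.isProbabilityMeasure_map (hm.measurable_state k).aemeasurable

theorem map_state_succ (hm : IsModel ρp ρm a θ μ₀ X ξ ε ζ P) (k : ℕ) :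
    P.map (fun ω => (X (k + 1) ω, ξ (k + 1) ω))
      = (P.map fun ω => (X k ω, ξ k ω)).bind (transitionKernel ρp ρm a θ) := by
  have := hm.isProbabilityMeasure_map k
  have := hm.isProbabilityMeasure_map (k + 1)
  have : IsProbabilityMeasure
      ((P.map fun ω => (X k ω, ξ k ω)).bind (transitionKernel ρp ρm a θ)) :=
    isProbabilityMeasure_bind (Kernel.aemeasurable _) (.of_forall fun _ => inferInstance)
  refine ext_of_integral_eq fun h hh h1 => ?_
  rw [integral_map (hm.measurable_state _).aemeasurable hh.aestronglyMeasurable,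
    integral_bind_kernel _ _ hh h1, integral_map (hm.measurable_state _).aemeasurable
      (measurable_integral_kernel _ hh).aestronglyMeasurable, hm.integral_state_add k 1 hh h1,
    pow_one]

theorem map_state_of_invariant (hm : IsModel ρp ρm a θ μ₀ X ξ ε ζ P)
    (hinv : (transitionKernel ρp ρm a θ).Invariant μ₀) (j : ℕ) :
    P.map (fun ω => (X j ω, ξ j ω)) = μ₀ := by
  induction j with
  | zero => exact hm.init_law
  | succ j ih => rw [hm.map_state_succ, ih, hinv.def]

theorem lintegral_lyapunov_le (hm : IsModel ρp ρm a θ μ₀ X ξ ε ζ P) (hρp : |ρp| < 1)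
    (hρm : |ρm| < 1) (ha : |a| < 1) {M : ℝ} (hM0 : 0 ≤ M)
    (hM : lyapunovRate ρp ρm a * M + lyapunovConst a ≤ M)
    (h0 : ∫⁻ z, ENNReal.ofReal (lyapunov a z) ∂μ₀ ≤ ENNReal.ofReal M) (k : ℕ) :
    ∫⁻ z, ENNReal.ofReal (lyapunov a z) ∂(P.map fun ω => (X k ω, ξ k ω)) ≤ ENNReal.ofReal M := by
  induction k with
  | zero => rw [hm.init_law]; exact h0
  | succ k ih =>
    have := hm.isProbabilityMeasure_map k
    rw [hm.map_state_succ]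
    exact (driftMinorization hρp hρm ha θ 0).lintegral_bind_le lyapunovRate_pos.le
      (lyapunovConst_pos ha).le hM0 hM ih

theorem integrable_weight (hm : IsModel ρp ρm a θ μ₀ X ξ ε ζ P) (hρp : |ρp| < 1)
    (hρm : |ρm| < 1) (ha : |a| < 1) {M : ℝ} (hM0 : 0 ≤ M)
    (hM : lyapunovRate ρp ρm a * M + lyapunovConst a ≤ M)
    (h0 : ∫⁻ z, ENNReal.ofReal (lyapunov a z) ∂μ₀ ≤ ENNReal.ofReal M) (k : ℕ) :
    Integrable (fun ω => 1 + |X k ω| + |ξ k ω|) P ∧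
      ∫ ω, (1 + |X k ω| + |ξ k ω|) ∂P ≤ 1 + M := by
  have := hm.isProb
  obtain ⟨i1, l1⟩ := integrable_of_lintegral_ofReal_le (measurable_lyapunov a) (lyapunov_nonneg ha)
    hM0 (hm.lintegral_lyapunov_le hρp hρm ha hM0 hM h0 k)
  have i2 : Integrable (fun ω => lyapunov a (X k ω, ξ k ω)) P :=
    i1.comp_measurable (hm.measurable_state k)
  rw [integral_map (hm.measurable_state k).aemeasurable
    (measurable_lyapunov a).aestronglyMeasurable] at l1
  have i3 : Integrable (fun ω => 1 + lyapunov a (X k ω, ξ k ω)) P := (integrable_const 1).add i2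
  have hb := two_le_lyapunovWeight ha
  have hle : ∀ ω, 1 + |X k ω| + |ξ k ω| ≤ 1 + lyapunov a (X k ω, ξ k ω) := fun ω => by
    unfold lyapunov
    nlinarith [abs_nonneg (ξ k ω)]
  have hX : Measurable (X k) := measurable_fst.comp (hm.measurable_state k)
  have hξ : Measurable (ξ k) := measurable_snd.comp (hm.measurable_state k)
  have i4 : Integrable (fun ω => 1 + |X k ω| + |ξ k ω|) P := by
    refine i3.mono' (by fun_prop) (.of_forall fun ω => ?_)
    rw [Real.norm_of_nonneg (by positivity)]
    exact hle ω
  refine ⟨i4, (integral_mono i4 i3 hle).trans ?_⟩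
  rw [integral_add (integrable_const _) i2]
  simpa using l1

theorem measurable_state_comap (hm : IsModel ρp ρm a θ μ₀ X ξ ε ζ P) (k i : ℕ) :
    Measurable[MeasurableSpace.comap (fun ω => ((X k ω, ξ k ω),
      fun i : ℕ => (ε (k + 1 + i) ω, ζ (k + 1 + i) ω))) inferInstance]
      fun ω => (X (k + i) ω, ξ (k + i) ω) := by
  induction i with
  | zero => exact measurable_fst.comp (comap_measurable _)
  | succ i ih =>
    have e : (fun ω => (X (k + (i + 1)) ω, ξ (k + (i + 1)) ω)) = fun ω =>
        step ρp ρm a θ (X (k + i) ω, ξ (k + i) ω) (ε (k + 1 + i) ω, ζ (k + 1 + i) ω) := by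
      ext1 ω
      rw [← add_assoc, hm.state_succ, Nat.add_right_comm k i 1]
    rw [e]
    have hi : Measurable fun q : (ℝ × ℝ) × (ℕ → ℝ × ℝ) => q.2 i := by fun_prop
    exact (measurable_step ρp ρm a θ).comp (ih.prodMk (hi.comp (comap_measurable _)))

/-- The future from time `k + 1` is generated by the state at time `k` and the later noises. -/
theorem future_le_comap (hm : IsModel ρp ρm a θ μ₀ X ξ ε ζ P) (k : ℕ) :
    future X ξ ε ζ (k + 1) ≤ MeasurableSpace.comap (fun ω => ((X k ω, ξ k ω),
      fun i : ℕ => (ε (k + 1 + i) ω, ζ (k + 1 + i) ω))) inferInstance := by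
  refine iSup₂_le fun j hj => ?_
  obtain ⟨i, rfl⟩ := Nat.exists_eq_add_of_le hj
  refine sup_le ?_ ?_
  · have h := hm.measurable_state_comap k (1 + i)
    rw [← add_assoc] at h
    rw [measurable_iff_comap_le] at h
    exact (MeasurableSpace.comap_prodMk (X (k + 1 + i)) (ξ (k + 1 + i))).symm.le.trans h
  · refine (MeasurableSpace.comap_prodMk (ε (k + 1 + i)) (ζ (k + 1 + i))).symm.le.trans ?_
    rw [← measurable_iff_comap_le]
    have hi : Measurable fun q : (ℝ × ℝ) × (ℕ → ℝ × ℝ) => q.2 i := by fun_prop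
    exact hi.comp (comap_measurable _)

theorem exists_eq_of_measurable_future (hm : IsModel ρp ρm a θ μ₀ X ξ ε ζ P) (k : ℕ) {H : Ω → ℝ}
    (hH : Measurable[future X ξ ε ζ (k + 1)] H) (h1 : ∀ ω, |H ω| ≤ 1) :
    ∃ Ψ : (ℝ × ℝ) × (ℕ → ℝ × ℝ) → ℝ, Measurable Ψ ∧ (∀ q, |Ψ q| ≤ 1) ∧
      ∀ ω, H ω = Ψ ((X k ω, ξ k ω), fun i : ℕ => (ε (k + 1 + i) ω, ζ (k + 1 + i) ω)) := by
  obtain ⟨Ψ, hΨ, e⟩ := (hH.mono (hm.future_le_comap k) le_rfl).exists_eq_measurable_comp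
  refine ⟨fun q => max (-1) (min 1 (Ψ q)), measurable_const.max (measurable_const.min hΨ),
    fun q => abs_le.2 ⟨le_max_left _ _, max_le (by norm_num) (min_le_left _ _)⟩, fun ω => ?_⟩
  have e' := congrFun e ω
  simp only [Function.comp_apply] at e'
  obtain ⟨h2, h3⟩ := abs_le.1 (h1 ω)
  simp only
  rw [← e', min_eq_right h3, max_eq_right h2]

theorem condExp_future (hm : IsModel ρp ρm a θ μ₀ X ξ ε ζ P) (k : ℕ)
    {Ψ : (ℝ × ℝ) × (ℕ → ℝ × ℝ) → ℝ} (hΨ : Measurable Ψ) (h1 : ∀ q, |Ψ q| ≤ 1) :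
    P[fun ω => Ψ ((X k ω, ξ k ω), fun i : ℕ => (ε (k + 1 + i) ω, ζ (k + 1 + i) ω)) | past ε ζ k]
      =ᵐ[P] fun ω => ∫ t, Ψ ((X k ω, ξ k ω), t) ∂(Measure.infinitePi fun _ : ℕ => noiseLaw) := by
  have := hm.isProb
  rw [← hm.map_tail k]
  exact condExp_of_indep (hm.past_le k) (hm.measurable_state_past k) (hm.measurable_tail k)
    (hm.indep_past_tail k) hΨ h1

end IsModel

namespace IsModel

variable {Ω : Type*} [MeasurableSpace Ω] {ρp ρm a θ : ℝ} {μ₀ π : Measure (ℝ × ℝ)}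
  {X ξ ε ζ : ℕ → Ω → ℝ} {P Pst : Measure Ω}

theorem integral_abs_sub_le (hm : IsModel ρp ρm a θ μ₀ X ξ ε ζ P) {C r M : ℝ} (hC : 0 ≤ C)
    (hr : 0 ≤ r)
    (herg : ∀ (n : ℕ) (h : ℝ × ℝ → ℝ), Measurable h → (∀ z, |h z| ≤ 1) → ∀ x y : ℝ,
      |(∫ z, h z ∂((transitionKernel ρp ρm a θ ^ n) (x, y))) - ∫ z, h z ∂π|
        ≤ C * r ^ n * (1 + |x| + |y|))
    (hw : ∀ k, Integrable (fun ω => 1 + |X k ω| + |ξ k ω|) P ∧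
      ∫ ω, (1 + |X k ω| + |ξ k ω|) ∂P ≤ 1 + M)
    (k n : ℕ) {h : ℝ × ℝ → ℝ} (hh : Measurable h) (h1 : ∀ z, |h z| ≤ 1) :
    ∫ ω, |(∫ z, h z ∂((transitionKernel ρp ρm a θ ^ n) (X k ω, ξ k ω))) - ∫ z, h z ∂π| ∂P
      ≤ C * r ^ n * (1 + M) := by
  have := hm.isProb
  obtain ⟨hi, hle⟩ := hw k
  have hκ : Measurable fun ω =>
      ∫ z, h z ∂((transitionKernel ρp ρm a θ ^ n) (X k ω, ξ k ω)) :=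
    (measurable_integral_kernel (transitionKernel ρp ρm a θ ^ n) hh).comp (hm.measurable_state k)
  have i1 : Integrable (fun ω => (∫ z, h z ∂((transitionKernel ρp ρm a θ ^ n) (X k ω, ξ k ω)))
      - ∫ z, h z ∂π) P :=
    (integrable_of_abs_le hκ fun ω => abs_integral_le_of_abs_le h1).sub (integrable_const _)
  calc ∫ ω, |(∫ z, h z ∂((transitionKernel ρp ρm a θ ^ n) (X k ω, ξ k ω))) - ∫ z, h z ∂π| ∂P
      ≤ ∫ ω, C * r ^ n * (1 + |X k ω| + |ξ k ω|) ∂P :=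
        integral_mono i1.abs (hi.const_mul _) fun ω => herg n h hh h1 _ _
    _ ≤ C * r ^ n * (1 + M) := by
        rw [integral_const_mul]
        exact mul_le_mul_of_nonneg_left hle (by positivity)

theorem isGeomMixing (hm : IsModel ρp ρm a θ μ₀ X ξ ε ζ P) {C r M : ℝ} (hC : 0 ≤ C)
    (hr : 0 ≤ r) (hM : 0 ≤ M)
    (herg : ∀ (n : ℕ) (h : ℝ × ℝ → ℝ), Measurable h → (∀ z, |h z| ≤ 1) → ∀ x y : ℝ,
      |(∫ z, h z ∂((transitionKernel ρp ρm a θ ^ n) (x, y))) - ∫ z, h z ∂π|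
        ≤ C * r ^ n * (1 + |x| + |y|))
    (hw : ∀ k, Integrable (fun ω => 1 + |X k ω| + |ξ k ω|) P ∧
      ∫ ω, (1 + |X k ω| + |ξ k ω|) ∂P ≤ 1 + M) {C' : ℝ} (hC' : 2 * (C * (1 + M)) ≤ C') :
    IsGeomMixing C' r X ξ P := by
  have := hm.isProb
  intro k m g h hg hh g1 h1
  set κh : Ω → ℝ := fun ω => ∫ z, h z ∂((transitionKernel ρp ρm a θ ^ m) (X k ω, ξ k ω)) with hκh
  set G : Ω → ℝ := fun ω => g (X k ω, ξ k ω) with hG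
  set c := ∫ z, h z ∂π
  have key := hm.integral_abs_sub_le hC hr herg hw k m hh h1
  have hκm : Measurable κh :=
    (measurable_integral_kernel (transitionKernel ρp ρm a θ ^ m) hh).comp (hm.measurable_state k)
  have hκ1 : ∀ ω, |κh ω| ≤ 1 := fun ω => abs_integral_le_of_abs_le h1
  have hκi : Integrable κh P := integrable_of_abs_le hκm hκ1
  have hGm : Measurable[past ε ζ k] G := hg.comp (hm.measurable_state_past k)
  have hGm' : Measurable G := hGm.mono (hm.past_le k) le_rfl
  have hG1 : ∀ ω, |G ω| ≤ 1 := fun ω => g1 _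
  have hGi : Integrable G P := integrable_of_abs_le hGm' hG1
  have hhi : Integrable (fun ω => h (X (k + m) ω, ξ (k + m) ω)) P :=
    integrable_of_abs_le (hh.comp (hm.measurable_state (k + m))) fun ω => h1 _
  have e1 : ∫ ω, G ω * h (X (k + m) ω, ξ (k + m) ω) ∂P = ∫ ω, G ω * κh ω ∂P := by
    rw [← integral_condExp (hm.past_le k)]
    refine integral_congr_ae ?_
    have h2 := condExp_stronglyMeasurable_mul_of_bound (hm.past_le k) hGm.stronglyMeasurable hhi 1
      (.of_forall hG1)
    filter_upwards [h2, hm.isMarkovChain k m h hh h1] with ω h3 h4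
    have h5 : (P[G * fun ω => h (X (k + m) ω, ξ (k + m) ω) | past ε ζ k]) ω = G ω * κh ω := by
      rw [h3, Pi.mul_apply, h4]
    exact h5
  have e2 : ∫ ω, h (X (k + m) ω, ξ (k + m) ω) ∂P = ∫ ω, κh ω ∂P :=
    hm.integral_state_add k m hh h1
  have hdi : Integrable (fun ω => κh ω - c) P := hκi.sub (integrable_const c)
  have hGdi : Integrable (fun ω => G ω * (κh ω - c)) P :=
    hdi.bdd_mul hGm'.aestronglyMeasurable (.of_forall hG1)
  have e3 : ∫ ω, G ω * κh ω ∂P - (∫ ω, G ω ∂P) * ∫ ω, κh ω ∂P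
      = ∫ ω, G ω * (κh ω - c) ∂P - (∫ ω, G ω ∂P) * ∫ ω, (κh ω - c) ∂P := by
    have h6 : ∫ ω, G ω * κh ω ∂P = ∫ ω, G ω * (κh ω - c) ∂P + (∫ ω, G ω ∂P) * c := by
      rw [← integral_mul_const, ← integral_add hGdi (hGi.mul_const c)]
      refine integral_congr_ae (.of_forall fun ω => ?_)
      simp only
      ring
    have h7 : ∫ ω, (κh ω - c) ∂P = ∫ ω, κh ω ∂P - c := by
      rw [integral_sub hκi (integrable_const c)]
      simp
    rw [h6, h7]
    ring
  have b1 : |∫ ω, G ω * (κh ω - c) ∂P| ≤ C * r ^ m * (1 + M) := by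
    refine le_trans ?_ key
    rw [← Real.norm_eq_abs]
    refine norm_integral_le_of_norm_le hdi.abs (.of_forall fun ω => ?_)
    rw [norm_mul, Real.norm_eq_abs, Real.norm_eq_abs]
    exact mul_le_of_le_one_left (abs_nonneg _) (hG1 ω)
  have b2 : |∫ ω, (κh ω - c) ∂P| ≤ C * r ^ m * (1 + M) := by
    refine le_trans ?_ key
    rw [← Real.norm_eq_abs]
    exact norm_integral_le_of_norm_le hdi.abs (.of_forall fun ω => le_rfl)
  have b3 : |∫ ω, G ω ∂P| ≤ 1 := abs_integral_le_of_abs_le hG1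
  rw [e1, e2, e3]
  have hrm : 0 ≤ r ^ m := pow_nonneg hr m
  have hrk : 0 ≤ r ^ k := pow_nonneg hr k
  have hC0 : 0 ≤ C' := le_trans (by positivity) hC'
  calc |∫ ω, G ω * (κh ω - c) ∂P - (∫ ω, G ω ∂P) * ∫ ω, (κh ω - c) ∂P|
      ≤ |∫ ω, G ω * (κh ω - c) ∂P| + |(∫ ω, G ω ∂P) * ∫ ω, (κh ω - c) ∂P| := abs_sub _ _
    _ ≤ C * r ^ m * (1 + M) + C * r ^ m * (1 + M) := by
        rw [abs_mul]
        exact add_le_add b1 ((mul_le_of_le_one_left (abs_nonneg _) b3).trans b2)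
    _ = 2 * (C * (1 + M)) * r ^ m := by ring
    _ ≤ C' * r ^ m := mul_le_mul_of_nonneg_right hC' hrm
    _ ≤ C' * r ^ m * (1 + r ^ k) :=
        le_mul_of_one_le_right (by positivity) (by linarith)

theorem futureForgetsPast (hm : IsModel ρp ρm a θ μ₀ X ξ ε ζ P)
    (hst : IsModel ρp ρm a θ π X ξ ε ζ Pst) (hinv : (transitionKernel ρp ρm a θ).Invariant π)
    {C r M : ℝ} (hC : 0 ≤ C) (hr : 0 < r)
    (herg : ∀ (n : ℕ) (h : ℝ × ℝ → ℝ), Measurable h → (∀ z, |h z| ≤ 1) → ∀ x y : ℝ,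
      |(∫ z, h z ∂((transitionKernel ρp ρm a θ ^ n) (x, y))) - ∫ z, h z ∂π|
        ≤ C * r ^ n * (1 + |x| + |y|))
    (hw : ∀ k, Integrable (fun ω => 1 + |X k ω| + |ξ k ω|) P ∧
      ∫ ω, (1 + |X k ω| + |ξ k ω|) ∂P ≤ 1 + M) {C' : ℝ} (hC' : C * (1 + M) / r ≤ C')
    (hC2 : 2 ≤ C') :
    FutureForgetsPast C' r X ξ ε ζ P Pst := by
  have := hm.isProb
  have := hst.isProb
  intro k n H hH h1
  cases n with
  | zero =>
    have b1 := ae_bdd_abs_condExp_of_ae_bdd_abs (m := past ε ζ k) (μ := P) (R := (1 : ℝ)) (f := H)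
      (.of_forall h1)
    have b2 : |∫ ω, H ω ∂Pst| ≤ 1 := abs_integral_le_of_abs_le h1
    calc ∫ ω, |(P[H | past ε ζ k]) ω - ∫ ω', H ω' ∂Pst| ∂P ≤ ∫ _, (2 : ℝ) ∂P := by
          refine integral_mono_ae (integrable_condExp.sub (integrable_const _)).abs
            (integrable_const _) ?_
          filter_upwards [b1] with ω hω
          refine (abs_sub _ _).trans ?_
          linarith
      _ = 2 := by simp
      _ ≤ C' * r ^ 0 := by simpa using hC2
  | succ n =>
    obtain ⟨Ψ, hΨ, hΨ1, e⟩ := hm.exists_eq_of_measurable_future (k + n) hH h1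
    have eH : H = fun ω => Ψ ((X (k + n) ω, ξ (k + n) ω),
        fun i : ℕ => (ε (k + n + 1 + i) ω, ζ (k + n + 1 + i) ω)) := funext e
    set h : ℝ × ℝ → ℝ := fun z => ∫ t, Ψ (z, t) ∂(Measure.infinitePi fun _ : ℕ => noiseLaw)
      with hh
    have hhm : Measurable h := hΨ.stronglyMeasurable.integral_prod_right'.measurable
    have hh1 : ∀ z, |h z| ≤ 1 := fun z => abs_integral_le_of_abs_le fun t => hΨ1 (z, t)
    have e1 : P[H | past ε ζ k]
        =ᵐ[P] fun ω => ∫ z, h z ∂((transitionKernel ρp ρm a θ ^ n) (X k ω, ξ k ω)) := by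
      have c1 := (condExp_condExp_of_le (f := H) (μ := P) (past_mono ε ζ (Nat.le_add_right k n))
        (hm.past_le (k + n))).symm
      have c2 : P[H | past ε ζ (k + n)] =ᵐ[P] fun ω => h (X (k + n) ω, ξ (k + n) ω) := by
        rw [eH]
        exact hm.condExp_future (k + n) hΨ hΨ1
      exact c1.trans ((condExp_congr_ae c2).trans (hm.isMarkovChain k n h hhm hh1))
    have e2 : ∫ ω, H ω ∂Pst = ∫ z, h z ∂π := by
      have c2 : Pst[H | past ε ζ (k + n)] =ᵐ[Pst] fun ω => h (X (k + n) ω, ξ (k + n) ω) := by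
        rw [eH]
        exact hst.condExp_future (k + n) hΨ hΨ1
      rw [← integral_condExp (hst.past_le (k + n)), integral_congr_ae c2,
        ← hst.map_state_of_invariant hinv (k + n),
        integral_map (hst.measurable_state _).aemeasurable hhm.aestronglyMeasurable]
    have e3 : ∫ ω, |(P[H | past ε ζ k]) ω - ∫ ω', H ω' ∂Pst| ∂P
        = ∫ ω, |(∫ z, h z ∂((transitionKernel ρp ρm a θ ^ n) (X k ω, ξ k ω)))
            - ∫ z, h z ∂π| ∂P := by
      refine integral_congr_ae ?_
      filter_upwards [e1] with ω hω
      rw [hω, e2]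
    rw [e3]
    refine (hm.integral_abs_sub_le hC hr.le herg hw k n hhm hh1).trans ?_
    have hrn : 0 ≤ r ^ (n + 1) := by positivity
    calc C * r ^ n * (1 + M) = C * (1 + M) / r * r ^ (n + 1) := by
          rw [pow_succ]; field_simp
      _ ≤ C' * r ^ (n + 1) := mul_le_mul_of_nonneg_right hC' hrn

/-- Tilting the law of the initial state gives a model with any dominated initial law. -/
theorem exists_of_absolutelyContinuous (hm : IsModel ρp ρm a θ μ₀ X ξ ε ζ P)
    [IsProbabilityMeasure μ₀] [IsProbabilityMeasure π] (hπ : π ≪ μ₀) :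
    ∃ Q : Measure Ω, IsModel ρp ρm a θ π X ξ ε ζ Q := by
  have := hm.isProb
  have h0 : Measurable[MeasurableSpace.comap (fun ω => (ε 0 ω, ζ 0 ω)) inferInstance]
      fun ω => (X 0 ω, ξ 0 ω) := by
    refine (hm.measurable_state_past 0).mono ?_ le_rfl
    rw [past_eq]
    refine iSup₂_le fun i hi => ?_
    obtain rfl : i = 0 := Nat.le_zero.1 hi
    exact le_rfl
  obtain ⟨Φ, hΦ, hΦe⟩ := h0.exists_eq_measurable_comp
  have hD : Measurable (π.rnDeriv μ₀) := Measure.measurable_rnDeriv _ _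
  have hg : Measurable fun w => π.rnDeriv μ₀ (Φ w) := hD.comp hΦ
  have hZ := hm.measurable_state 0
  have hgZ : ∀ ω, π.rnDeriv μ₀ (Φ (ε 0 ω, ζ 0 ω)) = π.rnDeriv μ₀ (X 0 ω, ξ 0 ω) := fun ω =>
    congrArg (π.rnDeriv μ₀) (congrFun hΦe ω).symm
  have hg1 : ∫⁻ ω, π.rnDeriv μ₀ (Φ (ε 0 ω, ζ 0 ω)) ∂P = 1 := by
    simp_rw [hgZ]
    rw [← lintegral_map hD hZ, hm.init_law, Measure.lintegral_rnDeriv hπ, measure_univ]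
  have hind := iIndepFun_withDensity (fun i => hm.measurable_noise i) hm.indep hg hg1
  refine ⟨P.withDensity fun ω => π.rnDeriv μ₀ (Φ (ε 0 ω, ζ 0 ω)), ?_, hm.meas_ε, hm.meas_ζ, hind,
    fun j hj => ?_, hm.init_X, hm.init_ξ, ?_, hm.rec_X, hm.rec_ξ⟩
  · exact hind.isProbabilityMeasure
  · rw [map_withDensity_of_ne_zero (fun i => hm.measurable_noise i) hm.indep hg hg1 (by omega)]
    exact hm.noise_law j hj
  · conv_rhs => rw [← Measure.withDensity_rnDeriv_eq π μ₀ hπ]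
    ext s hs
    rw [Measure.map_apply hZ hs, withDensity_apply _ (hZ hs), withDensity_apply _ hs,
      ← hm.init_law, setLIntegral_map hs (by rw [hm.init_law]; exact hD) hZ, hm.init_law]
    simp_rw [hgZ]

theorem real_state_fst_mem (hm : IsModel ρp ρm a θ μ₀ X ξ ε ζ P) {p : ℝ × ℝ → ℝ}
    (hp : Measurable p) (hp0 : ∀ z, 0 ≤ p z) [IsProbabilityMeasure (densityMeasure p)] {j : ℕ}
    (hj : P.map (fun ω => (X j ω, ξ j ω)) = densityMeasure p) {s : Set ℝ} (hs : MeasurableSet s) :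
    P.real {ω | X j ω ∈ s} = ∫ x in s, ∫ y, p (x, y) := by
  have h1 : ∫⁻ z, ENNReal.ofReal (p z) = 1 := by
    have := measure_univ (μ := densityMeasure p)
    rwa [densityMeasure, withDensity_apply _ .univ, Measure.restrict_univ] at this
  have hpi : Integrable p := by
    refine ⟨hp.aestronglyMeasurable, ?_⟩
    rw [hasFiniteIntegral_iff_ofReal (.of_forall hp0), h1]
    exact ENNReal.one_lt_top
  have e1 : P.real {ω | X j ω ∈ s} = (densityMeasure p).real (s ×ˢ Set.univ) := by
    rw [← hj, map_measureReal_apply (hm.measurable_state j) (hs.prod .univ)]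
    congr 1
    ext ω
    simp
  rw [e1, measureReal_def, densityMeasure, withDensity_apply _ (hs.prod .univ),
    ← integral_eq_lintegral_of_nonneg_ae (.of_forall hp0) hp.aestronglyMeasurable]
  rw [Measure.volume_eq_prod] at hpi ⊢
  rw [setIntegral_prod _ hpi.integrableOn]
  simp

end IsModel

theorem densityMeasure_absolutelyContinuous_gaussian (p : ℝ × ℝ → ℝ) {γ : ℝ≥0} (hγ : γ ≠ 0) :
    densityMeasure p ≪ (gaussianReal 0 1).prod (gaussianReal 0 γ) := by
  refine (withDensity_absolutelyContinuous _ _).trans ?_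
  rw [Measure.volume_eq_prod]
  exact (gaussianReal_absolutelyContinuous' 0 one_ne_zero).prod
    (gaussianReal_absolutelyContinuous' 0 hγ)

theorem integrable_lyapunov_gaussian (a : ℝ) (γ : ℝ≥0) :
    Integrable (lyapunov a) ((gaussianReal 0 1).prod (gaussianReal 0 γ)) :=
  ((integrable_abs_gaussianReal 0 1).comp_fst _).add
    (((integrable_abs_gaussianReal 0 γ).comp_snd _).const_mul _)

end TAR

theorem proposition1 (ρp ρm a : ℝ) (hρp : |ρp| < 1) (hρm : |ρm| < 1) (ha : |a| < 1)
    (γ : ℝ≥0) (hγ_pos : 0 < γ)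
    (hγ : (γ : ℝ) = a ^ 2 * γ + 1 - a ^ 2 * (γ : ℝ) ^ 2 / (1 + γ)) :
    ∃ (B C r : ℝ) (L : ℝ → ℝ), 0 < B ∧ 0 < C ∧ 0 < r ∧ r < 1 ∧ ∀ θ : ℝ,
      ∃ p : ℝ × ℝ → ℝ,
        -- `p` is a bounded continuous probability density
        Continuous p ∧ (∀ z, 0 ≤ p z ∧ p z ≤ B) ∧
        IsProbabilityMeasure (TAR.densityMeasure p) ∧
        -- it is invariant, and it is the only invariant probability
        (TAR.transitionKernel ρp ρm a θ).Invariant (TAR.densityMeasure p) ∧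
        (∀ μ : Measure (ℝ × ℝ), IsProbabilityMeasure μ →
          (TAR.transitionKernel ρp ρm a θ).Invariant μ → μ = TAR.densityMeasure p) ∧
        -- the stationary probability that `X` lies in a short interval at the threshold
        (∀ x, Integrable (fun y => p (x, y))) ∧
        (∀ v : ℝ, 0 ≤ v → ∀ n : ℕ, 1 ≤ n →
          |(∫ x in Set.Icc θ (θ + v / n), ∫ y, p (x, y)) - v / n * ∫ y, p (θ, y)|
            ≤ L v / (n : ℝ) ^ 2) ∧
        -- geometric ergodicity
        (∀ (n : ℕ) (h : ℝ × ℝ → ℝ), Measurable h → (∀ z, |h z| ≤ 1) → ∀ x y : ℝ,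
          |(∫ z, h z ∂((TAR.transitionKernel ρp ρm a θ ^ n) (x, y)))
              - ∫ z, h z ∂(TAR.densityMeasure p)| ≤ C * r ^ n * (1 + |x| + |y|)) ∧
        -- the process itself, under `P` (`X_0`, `ξ_0` independent, `N(0,1)` and `N(0,γ)`)
        -- and under a stationary probability `Pst` on the same space
        (∀ (Ω : Type*) [MeasurableSpace Ω] (X ξ ε ζ : ℕ → Ω → ℝ) (P : Measure Ω),
          TAR.IsModel ρp ρm a θ ((gaussianReal 0 1).prod (gaussianReal 0 γ)) X ξ ε ζ P →
          TAR.IsMarkovChain (TAR.transitionKernel ρp ρm a θ) X ξ ε ζ P ∧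
          TAR.IsGeomMixing C r X ξ P ∧
          (∃ Pst : Measure Ω,
            TAR.IsModel ρp ρm a θ (TAR.densityMeasure p) X ξ ε ζ Pst) ∧
          (∀ Pst : Measure Ω,
            TAR.IsModel ρp ρm a θ (TAR.densityMeasure p) X ξ ε ζ Pst →
            TAR.IsMarkovChain (TAR.transitionKernel ρp ρm a θ) X ξ ε ζ Pst ∧
            (∀ j, Pst.map (fun ω => (X j ω, ξ j ω)) = TAR.densityMeasure p) ∧
            (∀ (v : ℝ), 0 ≤ v → ∀ n : ℕ, 1 ≤ n → ∀ j,
              Pst.real {ω | X j ω ∈ Set.Icc θ (θ + v / n)}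
                = ∫ x in Set.Icc θ (θ + v / n), ∫ y, p (x, y)) ∧
            TAR.FutureForgetsPast C r X ξ ε ζ P Pst ∧
            TAR.FutureForgetsPast C r X ξ ε ζ Pst Pst ∧
            TAR.IsGeomMixing C r X ξ Pst)) := by
  obtain ⟨C, r, M, hC, hr0, hr1, hM0, hM, H⟩ := TAR.exists_stationaryDensity hρp hρm ha
  have hl0 := TAR.lyapunov_nonneg (a := a) ha
  set M₀ := ∫ z, TAR.lyapunov a z ∂((gaussianReal 0 1).prod (gaussianReal 0 γ)) with hM₀
  set M' := max M M₀ with hM'd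
  have hM'0 : 0 ≤ M' := hM0.trans (le_max_left _ _)
  have hM' : TAR.lyapunovRate ρp ρm a * M' + TAR.lyapunovConst a ≤ M' := by
    have h1 := TAR.lyapunovRate_lt_one hρp hρm ha
    have h2 : M ≤ M' := le_max_left _ _
    nlinarith
  have hG : ∫⁻ z, ENNReal.ofReal (TAR.lyapunov a z)
      ∂((gaussianReal 0 1).prod (gaussianReal 0 γ)) ≤ ENNReal.ofReal M' := by
    rw [← ofReal_integral_eq_lintegral_ofReal (TAR.integrable_lyapunov_gaussian a γ)
      (.of_forall hl0)]
    exact ENNReal.ofReal_le_ofReal (le_max_right _ _)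
  have hCM : 0 ≤ C * (1 + M') := by positivity
  have hCMr : C * (1 + M') ≤ C * (1 + M') / r := le_div_self hCM hr0 hr1.le
  have hCC : C ≤ C * (1 + M') := le_mul_of_one_le_right hC.le (by linarith)
  set C' := 2 * (C * (1 + M') / r) + 2 with hC'
  refine ⟨1, C', r, fun v => v ^ 2, one_pos, by positivity, hr0, hr1, fun θ => ?_⟩
  obtain ⟨p, hpc, hpb, hpp, hinv, huniq, hpi, hplip, herg, hV⟩ := H θ
  have hV' := hV.trans (ENNReal.ofReal_le_ofReal (le_max_left M M₀))
  refine ⟨p, hpc, hpb, hpp, hinv, huniq, hpi, fun v hv n hn => ?_, fun n h hh h1 x y => ?_,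
    fun Ω _ X ξ ε ζ P hP => ?_⟩
  · have := TAR.abs_setIntegral_Icc_sub_le hplip θ (div_nonneg hv (Nat.cast_nonneg n))
    rwa [div_pow] at this
  · refine (herg n h hh h1 x y).trans ?_
    gcongr
    linarith
  · have hw := hP.integrable_weight hρp hρm ha hM'0 hM' hG
    refine ⟨hP.isMarkovChain, hP.isGeomMixing hC.le hr0.le hM'0 herg hw (by linarith),
      hP.exists_of_absolutelyContinuous
        (TAR.densityMeasure_absolutelyContinuous_gaussian p hγ_pos.ne'), fun Q hQ => ?_⟩
    have hwQ := hQ.integrable_weight hρp hρm ha hM'0 hM' hV'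
    exact ⟨hQ.isMarkovChain, hQ.map_state_of_invariant hinv,
      fun v _ n _ j => hQ.real_state_fst_mem hpc.measurable (fun z => (hpb z).1)
        (hQ.map_state_of_invariant hinv j) measurableSet_Icc,
      hP.futureForgetsPast hQ hinv hC.le hr0 herg hw (by linarith) (by linarith),
      hQ.futureForgetsPast hQ hinv hC.le hr0 herg hwQ (by linarith) (by linarith),
      hQ.isGeomMixing hC.le hr0.le hM'0 herg hwQ (by linarith)⟩
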